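/- Let $N\ge 0$ and let $S(z)=\sum_{n=-N}^{N} C_n z^n$, with $C_n\in\mathbb{C}^{m\times m}$, be a trigonometric matrix polynomial of order $N$, i.e. $C_N=C_{-N}^*\neq 0$ (the equality being automatic from the next hypothesis). Suppose that, for almost every $z$ on the unit circle $\mathbb{T}=\{z\in\mathbb{C}:|z|=1\}$, the matrix $S(z)$ is (Hermitian) nonnegative definite and has rank $k\le m$. Then there is an $m\times k$ matrix polynomial $$S^+(z)=\sum_{n=0}^{N} A_n z^n,\qquad A_n\in\mathbb{C}^{m\times k},$$ of order $N$ (i.e. $A_N\neq 0$), such that $S^+(z)$ has full rank $k$ for every $z$ with $|z|<1$ and $$S(z)=S^+(z)\,S^-(z)\quad\text{for all } z\in\mathbb{C}\setminus\{0\},\qquad\text{where } S^-(z)=\sum_{n=0}^{N} A_n^* z^{-n}$$ and $A_n^*$ is the conjugate transpose of $A_n$. The factor $S^+$ is unique up to a constant unitary right multiplier: an $m\times k$ matrix polynomial $S_1^+(z)=\sum_{n=0}^N B_n z^n$ has all of these properties if and only if $S_1^+(z)=S^+(z)U$ for all $z$, for some constant $k\times k$ unitary matrix $U$. -/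

import Mathlib

open MeasureTheory
open scoped ComplexOrder Matrix

/-- The trigonometric matrix polynomial `S(z) = ∑_{n=-N}^{N} C_n z^n`. Only the coefficients `C n`
with `-N ≤ n ≤ N` enter. -/
noncomputable def trigMatrixPoly {m : ℕ} (N : ℕ) (C : ℤ → Matrix (Fin m) (Fin m) ℂ) (z : ℂ) :
    Matrix (Fin m) (Fin m) ℂ :=
  ∑ n ∈ Finset.Icc (-(N : ℤ)) (N : ℤ), z ^ n • C n

/-- The matrix polynomial `S⁺(z) = ∑_{n=0}^{N} A_n z^n`. -/
noncomputable def plusPoly {m k N : ℕ} (A : Fin (N + 1) → Matrix (Fin m) (Fin k) ℂ) (z : ℂ) :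
    Matrix (Fin m) (Fin k) ℂ :=
  ∑ n : Fin (N + 1), z ^ (n : ℕ) • A n

/-- The adjoint `S⁻(z) = ∑_{n=0}^{N} A_n^* z^{-n}` of `S⁺`. -/
noncomputable def minusPoly {m k N : ℕ} (A : Fin (N + 1) → Matrix (Fin m) (Fin k) ℂ) (z : ℂ) :
    Matrix (Fin k) (Fin m) ℂ :=
  ∑ n : Fin (N + 1), z ^ (-((n : ℕ) : ℤ)) • (A n)ᴴ

/-- The coefficients `A_0, …, A_N` define a spectral factor of order `N` of the matrix function
`S`: the leading coefficient is nonzero, `S⁺(z)` has full rank `k` at every point of the open unit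
disc, and `S(z) = S⁺(z) S⁻(z)` for every `z ≠ 0`. -/
structure IsSpectralFactor {m k N : ℕ} (S : ℂ → Matrix (Fin m) (Fin m) ℂ)
    (A : Fin (N + 1) → Matrix (Fin m) (Fin k) ℂ) : Prop where
  order : A (Fin.last N) ≠ 0
  fullRank : ∀ z : ℂ, ‖z‖ < 1 → (plusPoly A z).rank = k
  factor : ∀ z : ℂ, z ≠ 0 → S z = plusPoly A z * minusPoly A z

/-! Existence. Positivity on a conull subset of the circle extends to the whole circle by
continuity, so the block Toeplitz matrices of S are positive semidefinite. Cholesky elimination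
respects their band (`Matrix.PosSemidef.exists_banded_decomposition`), so each Fejér sum equals B
B^* on the circle with B of degree at most N (`exists_factor_fejer_sum`). After rescaling, these
sums are Cesàro means converging to S, and compactness of the coefficients yields P with S = P P^*
on the circle (`exists_factor_on_circle`).

Among all such P with the same number of columns, one minimises the energy Σ n‖A_n‖². If P(a)v = 0
with |a| < 1 while Pv is not identically zero, replacing the factor z - a of Pv by 1 - ā z preserves
P P^* on the circle and lowers the energy (`exists_weightedEnergy_lt`). For a minimiser, every
kernel inside the disc is therefore the common kernel of the coefficients. Discarding it makes P
injective throughout the disc, and the number of remaining columns must be the generic rank k.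

Uniqueness. At all but finitely many points of the circle two factors differ by a unitary U(z). Full
rank in the disc makes the entries of both U and U^* rational without poles there, and boundedness
excludes poles on the circle. Reflection in the circle turns the statement for U^* into the absence
of poles of U outside the disc, so U is constant (`exists_const_on_circle`). -/

namespace Matrix

/-! ### Banded Cholesky decomposition -/

/-- A positive semidefinite matrix whose diagonal entry vanishes has a vanishing row. -/
theorem PosSemidef.apply_eq_zero_of_diag_eq_zero {ι : Type*} [Fintype ι] [DecidableEq ι]
    {T : Matrix ι ι ℂ} (hT : T.PosSemidef) {a : ι} (ha : T a a = 0) (i : ι) : T i a = 0 := by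
  have h := (hT.dotProduct_mulVec_zero_iff (Pi.single a 1)).1 (by simp [ha])
  simpa using congrFun h i

/-- One elimination step of the Cholesky decomposition. -/
theorem PosSemidef.sub_rankOne {ι : Type*} [Fintype ι] [DecidableEq ι]
    {T : Matrix ι ι ℂ} (hT : T.PosSemidef) {a : ι} (ha : T a a ≠ 0) :
    (Matrix.of fun i j => T i j - T i a * T a j / T a a).PosSemidef := by
  -- `E` is the column operation that clears row `a` of `T`. Since row `a` of `T * E` vanishes,
  -- multiplying by `Eᴴ` on the left changes nothing, and the Schur complement is the congruence `Eᴴ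
  -- * T * E`.
  set E : Matrix ι ι ℂ := 1 - Matrix.of fun i j => (Pi.single a 1 : ι → ℂ) i * (T a j / T a a)
  have hTE : T * E = Matrix.of fun i j => T i j - T i a * T a j / T a a := by
    ext i j
    rw [mul_sub, Matrix.mul_one, Matrix.sub_apply]
    simp [Matrix.mul_apply, Pi.single_apply, mul_div_assoc]
  have hE : (Eᴴ * (T * E)) = T * E := by
    have h0 : ∀ j, (T * E) a j = 0 := fun j => by
      rw [hTE]; simp [mul_div_cancel_left₀, ha]
    ext i j
    rw [Matrix.conjTranspose_sub, Matrix.conjTranspose_one, sub_mul, Matrix.one_mul,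
      Matrix.sub_apply, sub_eq_self, Matrix.mul_apply]
    refine Finset.sum_eq_zero fun l _ => ?_
    by_cases hl : l = a
    · rw [hl, h0, mul_zero]
    · simp [hl]
  rw [← hTE, ← hE, ← Matrix.mul_assoc]
  exact hT.conjTranspose_mul_mul_same E

/-- A banded positive semidefinite matrix is a sum of rank one matrices that are supported on
windows of the same width. -/
theorem PosSemidef.exists_banded_decomposition {ι : Type*} [Fintype ι] [DecidableEq ι]
    (β : ι → ℕ) (N : ℕ) (s : Finset ι) : ∀ T : Matrix ι ι ℂ, T.PosSemidef →
      (∀ i j, T i j ≠ 0 → β i ≤ β j + N) → (∀ i j, i ∉ s → T i j = 0) →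
      ∃ v : ι → ι → ℂ, (∀ j i, v j i ≠ 0 → β j ≤ β i ∧ β i ≤ β j + N) ∧
        (∀ j ∉ s, v j = 0) ∧ ∀ i i', T i i' = ∑ j, v j i * star (v j i') := by
  induction s using Finset.induction_on_min_value β with
  | empty =>
    intro T _ _ h
    exact ⟨0, by simp, by simp, fun i i' => by simp [h i i']⟩
  | insert a s ha hmin ih =>
    intro T hT hband hsupp
    have hherm : ∀ i j, star (T i j) = T j i := fun i j => hT.1.apply j i
    by_cases hd : T a a = 0
    · obtain ⟨v, h1, h2, h3⟩ := ih T hT hband (fun i j hi => by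
        by_cases hia : i = a
        · rw [hia, ← hherm, hT.apply_eq_zero_of_diag_eq_zero hd, star_zero]
        · exact hsupp i j (by simp [hia, hi]))
      exact ⟨v, h1, fun j hj => h2 j (fun h => hj (Finset.mem_insert_of_mem h)), h3⟩
    · have hdnn : 0 ≤ T a a := hT.diag_nonneg
      obtain ⟨v, h1, h2, h3⟩ := ih _ (hT.sub_rankOne hd)
        (fun i j hij => by
          simp only [Matrix.of_apply] at hij
          by_cases h : T i j = 0
          · have h' : T i a ≠ 0 ∧ T a j ≠ 0 := by
              constructor <;> intro h0 <;> simp [h, h0] at hij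
            have hj : j ∈ insert a s := by
              by_contra hj
              exact h'.2 (by rw [← hherm, hsupp j a hj, star_zero])
            have haj : β a ≤ β j := by
              rcases Finset.mem_insert.1 hj with rfl | hj
              · exact le_rfl
              · exact hmin j hj
            have := hband i a h'.1
            omega
          · exact hband i j h)
        (fun i j hi => by
          by_cases hia : i = a
          · subst hia
            simp [mul_div_cancel_left₀, hd]
          · have h0 : ∀ l, T i l = 0 := fun l => hsupp i l (by simp [hia, hi])
            simp [h0])
      set d : ℝ := (T a a).re
      have hdd : T a a = (d : ℂ) := (Complex.eq_re_of_ofReal_le hdnn)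
      have hd0 : 0 < d := by
        refine lt_of_le_of_ne (Complex.le_def.1 hdnn).1 fun h => hd (by rw [hdd, ← h]; simp)
      -- Slot `a` is free, because `a ∉ s` forces `v a = 0`. It receives the pivot column divided by
      -- the square root of the pivot.
      refine ⟨Function.update v a fun i => T i a / (Real.sqrt d : ℂ), ?_, ?_, ?_⟩
      · intro j i hji
        by_cases hja : j = a
        · subst hja
          have hia : T i j ≠ 0 := fun h => by simp [h] at hji
          refine ⟨?_, hband i j hia⟩
          have hi : i ∈ insert j s := by
            by_contra hi
            exact hia (hsupp i j hi)
          rcases Finset.mem_insert.1 hi with rfl | hi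
          · exact le_rfl
          · exact hmin i hi
        · rw [Function.update_of_ne hja] at hji
          exact h1 j i hji
      · intro j hj
        rw [Function.update_of_ne (fun h => hj (by simp [h]))]
        exact h2 j (fun h => hj (Finset.mem_insert_of_mem h))
      · intro i i'
        have h := h3 i i'
        rw [← Finset.add_sum_erase _ _ (Finset.mem_univ a)] at h ⊢
        have hrest : ∑ j ∈ Finset.univ.erase a,
            Function.update v a (fun i => T i a / (Real.sqrt d : ℂ)) j i *
              star (Function.update v a (fun i => T i a / (Real.sqrt d : ℂ)) j i') =
            ∑ j ∈ Finset.univ.erase a, v j i * star (v j i') :=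
          Finset.sum_congr rfl fun j hj => by
            rw [Function.update_of_ne (Finset.ne_of_mem_erase hj)]
        rw [hrest]
        simp only [h2 a ha, Pi.zero_apply, zero_mul, zero_add, Matrix.of_apply] at h
        rw [← h, Function.update_self, star_div₀, hherm, hdd]
        have hs : (Real.sqrt d : ℂ) * Real.sqrt d = d := by
          rw [← Complex.ofReal_mul, Real.mul_self_sqrt hd0.le]
        have : star (Real.sqrt d : ℂ) = Real.sqrt d := Complex.conj_ofReal _
        rw [this, div_mul_div_comm, hs]
        ring

end Matrix

/-! ### Discrete Fourier analysis and positivity on the circle -/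

/-- Orthogonality of characters on the roots of unity. -/
theorem sum_zpow_of_isPrimitiveRoot {ζ : ℂ} {L : ℕ} (hζ : IsPrimitiveRoot ζ L) {e : ℤ}
    (he : |e| < L) : ∑ l ∈ Finset.range L, (ζ ^ l) ^ e = if e = 0 then (L : ℂ) else 0 := by
  split_ifs with h
  · simp [h]
  · have h1 : ζ ^ e ≠ 1 := fun h1 => by
      have := Int.eq_zero_of_abs_lt_dvd ((hζ.zpow_eq_one_iff_dvd e).1 h1) he
      exact h this
    have h2 : ∀ l : ℕ, (ζ ^ l) ^ e = (ζ ^ e) ^ l := fun l => by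
      rw [← zpow_natCast, ← zpow_natCast, ← zpow_mul, ← zpow_mul, mul_comm]
    simp only [h2]
    rw [geom_sum_eq h1, ← h2, hζ.pow_eq_one]
    simp

theorem exists_isPrimitiveRoot_norm_eq_one {L : ℕ} (hL : L ≠ 0) :
    ∃ ζ : ℂ, IsPrimitiveRoot ζ L ∧ ∀ l : ℕ, ‖ζ ^ l‖ = 1 := by
  refine ⟨_, Complex.isPrimitiveRoot_exp L hL, fun l => ?_⟩
  rw [norm_pow, (Complex.isPrimitiveRoot_exp L hL).norm'_eq_one hL, one_pow]

/-- The value at `z` of the matrix polynomial with coefficients `A`, with arbitrary index types. -/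
noncomputable def matEval {ι κ : Type*} {N : ℕ} (A : Fin (N + 1) → Matrix ι κ ℂ) (z : ℂ) :
    Matrix ι κ ℂ :=
  ∑ n : Fin (N + 1), z ^ (n : ℕ) • A n

theorem matEval_apply {ι κ : Type*} {N : ℕ} (A : Fin (N + 1) → Matrix ι κ ℂ) (z : ℂ) (i : ι)
    (j : κ) : matEval A z i j = ∑ n : Fin (N + 1), z ^ (n : ℕ) * A n i j := by
  simp [matEval, Matrix.sum_apply]

/-- The coefficients of a trigonometric matrix polynomial, extended by zero. -/
noncomputable def bandCoeff {m : ℕ} (N : ℕ) (C : ℤ → Matrix (Fin m) (Fin m) ℂ) (n : ℤ) :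
    Matrix (Fin m) (Fin m) ℂ :=
  if n ∈ Finset.Icc (-(N : ℤ)) N then C n else 0

theorem bandCoeff_eq_zero {m N : ℕ} {C : ℤ → Matrix (Fin m) (Fin m) ℂ} {n : ℤ}
    (h : n ∉ Finset.Icc (-(N : ℤ)) N) : bandCoeff N C n = 0 := if_neg h

theorem trigMatrixPoly_eq_sum_bandCoeff {m N : ℕ} (C : ℤ → Matrix (Fin m) (Fin m) ℂ) (z : ℂ) :
    trigMatrixPoly N C z = ∑ n ∈ Finset.Icc (-(N : ℤ)) N, z ^ n • bandCoeff N C n :=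
  Finset.sum_congr rfl fun n hn => by rw [bandCoeff, if_pos hn]

theorem trigMatrixPoly_eq_sum_of_le {m N : ℕ} (C : ℤ → Matrix (Fin m) (Fin m) ℂ) (z : ℂ) {M : ℕ}
    (hM : N ≤ M) :
    trigMatrixPoly N C z = ∑ n ∈ Finset.Icc (-(M : ℤ)) M, z ^ n • bandCoeff N C n := by
  rw [trigMatrixPoly_eq_sum_bandCoeff]
  refine Finset.sum_subset (fun n hn => ?_) fun n _ hn => by rw [bandCoeff_eq_zero hn, smul_zero]
  simp only [Finset.mem_Icc] at hn ⊢
  omega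

theorem continuous_trigMatrixPoly_circle {m : ℕ} (N : ℕ) (C : ℤ → Matrix (Fin m) (Fin m) ℂ) :
    Continuous fun θ : ℝ => trigMatrixPoly N C (Circle.exp θ : ℂ) := by
  unfold trigMatrixPoly
  refine continuous_finsetSum _ fun n _ => Continuous.smul (?_ :
    Continuous fun θ : ℝ => (Circle.exp θ : ℂ) ^ n) continuous_const
  refine Continuous.zpow₀ (by fun_prop) n fun θ => Or.inl (Circle.coe_ne_zero _)

theorem isClosed_setOf_posSemidef {n : Type*} [Fintype n] :
    IsClosed {A : Matrix n n ℂ | A.PosSemidef} := by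
  have : {A : Matrix n n ℂ | A.PosSemidef} =
      {A | Aᴴ = A} ∩ ⋂ x : n → ℂ, {A | 0 ≤ star x ⬝ᵥ (A *ᵥ x)} := by
    ext A
    simp only [Set.mem_ofPred_eq, Set.mem_inter_iff, Set.mem_iInter]
    exact ⟨fun h => ⟨h.1, h.dotProduct_mulVec_nonneg⟩, fun h =>
      Matrix.PosSemidef.of_dotProduct_mulVec_nonneg h.1 h.2⟩
  rw [this]
  refine (isClosed_eq (by fun_prop) continuous_id).inter (isClosed_iInter fun x => ?_)
  exact isClosed_le continuous_const (by fun_prop)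

/-- Nonnegativity almost everywhere on the circle implies nonnegativity everywhere. -/
theorem trigMatrixPoly_posSemidef {m N : ℕ} {C : ℤ → Matrix (Fin m) (Fin m) ℂ}
    (hS : ∀ᵐ θ : ℝ, (trigMatrixPoly N C (Circle.exp θ : ℂ)).PosSemidef) {z : ℂ} (hz : ‖z‖ = 1) :
    (trigMatrixPoly N C z).PosSemidef := by
  -- A conull set of angles is dense and the positive semidefinite cone is closed.
  have hcl := isClosed_setOf_posSemidef.preimage (continuous_trigMatrixPoly_circle N C)
  have hd := Measure.dense_of_ae hS
  have : (trigMatrixPoly N C (Circle.exp (Complex.arg z) : ℂ)).PosSemidef := by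
    have h := hcl.closure_eq ▸ hd (Complex.arg z)
    exact h
  rwa [Circle.coe_exp, ← one_mul (Complex.exp _), ← Complex.ofReal_one, ← hz,
    Complex.norm_mul_exp_arg_mul_I] at this

theorem star_eq_inv_of_norm_eq_one {z : ℂ} (hz : ‖z‖ = 1) : star z = z⁻¹ := by
  rw [Complex.inv_def, Complex.normSq_eq_norm_sq, hz]
  simp

/-! ### Toeplitz matrices, Fejér sums and factorization on the circle -/

/-- The block Toeplitz matrices of a trigonometric polynomial that is nonnegative on the circle
are nonnegative. -/
theorem toeplitz_posSemidef {m N : ℕ} {C : ℤ → Matrix (Fin m) (Fin m) ℂ}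
    (hS : ∀ z : ℂ, ‖z‖ = 1 → (trigMatrixPoly N C z).PosSemidef) (M : ℕ) :
    (Matrix.of fun p q : Fin M × Fin m =>
      bandCoeff N C ((p.1 : ℤ) - (q.1 : ℤ)) p.2 q.2).PosSemidef := by
  -- The exponents `n - (p - q)` have absolute value at most N + M - 1 < L, so averaging over L-th
  -- roots of unity replaces the Fourier integral exactly.
  set L : ℕ := M + N + 1
  have hL : L ≠ 0 := by omega
  obtain ⟨ζ, hζ, hnorm⟩ := exists_isPrimitiveRoot_norm_eq_one hL
  set E : ℕ → Matrix (Fin M × Fin m) (Fin m) ℂ := fun l =>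
    Matrix.of fun p γ => if p.2 = γ then (ζ ^ l) ^ (-(p.1 : ℤ)) else 0
  have key : (Matrix.of fun p q : Fin M × Fin m =>
      bandCoeff N C ((p.1 : ℤ) - (q.1 : ℤ)) p.2 q.2) =
      ((L : ℝ)⁻¹) • ∑ l ∈ Finset.range L, E l * trigMatrixPoly N C (ζ ^ l) * (E l)ᴴ := by
    ext p q
    have hl : ∀ l ∈ Finset.range L, (E l * trigMatrixPoly N C (ζ ^ l) * (E l)ᴴ) p q =
        ∑ n ∈ Finset.Icc (-(N : ℤ)) N,
          (ζ ^ l) ^ (n - ((p.1 : ℤ) - (q.1 : ℤ))) * bandCoeff N C n p.2 q.2 := by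
      intro l _
      have h0 : ζ ^ l ≠ 0 := fun h => by simpa [h] using hnorm l
      have hs : star ((ζ ^ l) ^ (-(q.1 : ℤ))) = (ζ ^ l) ^ (q.1 : ℤ) := by
        rw [star_zpow₀, star_eq_inv_of_norm_eq_one (hnorm l), inv_zpow, zpow_neg, inv_inv]
      rw [trigMatrixPoly_eq_sum_bandCoeff]
      simp only [Matrix.mul_apply, E, Matrix.of_apply, Matrix.conjTranspose_apply, apply_ite star,
        star_zero, hs, ite_mul, zero_mul, mul_ite, mul_zero, Finset.sum_ite_eq, Finset.mem_univ,
        if_true, Matrix.sum_apply, Matrix.smul_apply, smul_eq_mul, Finset.mul_sum, Finset.sum_mul]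
      rw [Finset.sum_comm]
      simp only [Finset.sum_ite_eq, Finset.mem_univ, if_true]
      refine Finset.sum_congr rfl fun n _ => ?_
      rw [show n - ((p.1 : ℤ) - (q.1 : ℤ)) = -(p.1 : ℤ) + n + q.1 by ring, zpow_add₀ h0,
        zpow_add₀ h0]
      ring
    rw [Matrix.smul_apply, Matrix.sum_apply, Finset.sum_congr rfl hl, Finset.sum_comm]
    have hp := p.1.2
    have hq := q.1.2
    have hn : ∀ n ∈ Finset.Icc (-(N : ℤ)) N, (∑ l ∈ Finset.range L,
        (ζ ^ l) ^ (n - ((p.1 : ℤ) - (q.1 : ℤ))) * bandCoeff N C n p.2 q.2 : ℂ) =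
        if n = (p.1 : ℤ) - (q.1 : ℤ) then L * bandCoeff N C n p.2 q.2 else 0 := by
      intro n hn
      rw [Finset.mem_Icc] at hn
      rw [← Finset.sum_mul, sum_zpow_of_isPrimitiveRoot hζ (by rw [abs_lt]; constructor <;> omega)]
      simp [sub_eq_zero]
    rw [Finset.sum_congr rfl hn, Finset.sum_ite_eq']
    split_ifs with h
    · simp [hL]
    · simp [bandCoeff_eq_zero h]
  rw [key]
  refine Matrix.PosSemidef.smul (Matrix.posSemidef_sum _ fun l _ => ?_) (by positivity)
  exact (hS _ (hnorm l)).mul_mul_conjTranspose_same _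

/-- The product `P(z) P(w)^*` only depends on the Gram matrix of the coefficients. -/
theorem matEval_mul_conjTranspose_apply {ι κ : Type*} [Fintype κ] {N : ℕ}
    (A : Fin (N + 1) → Matrix ι κ ℂ) (z : ℂ) (i j : ι) :
    (matEval A z * (matEval A z)ᴴ) i j = ∑ n : Fin (N + 1), ∑ n' : Fin (N + 1),
      z ^ (n : ℕ) * star (z ^ (n' : ℕ)) * ∑ γ, A n i γ * star (A n' j γ) := by
  simp only [Matrix.mul_apply, Matrix.conjTranspose_apply, matEval_apply, star_sum, star_mul',
    Finset.sum_mul_sum]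
  simp only [Finset.mul_sum]
  rw [Finset.sum_comm]
  refine Finset.sum_congr rfl fun n _ => ?_
  rw [Finset.sum_comm]
  refine Finset.sum_congr rfl fun n' _ => Finset.sum_congr rfl fun γ _ => ?_
  ring

/-- The number of columns of a matrix polynomial can be made to depend only on its degree and its
number of rows. -/
theorem exists_matEval_mul_conjTranspose_eq {ι κ : Type*} [Fintype ι] [DecidableEq ι] [Fintype κ]
    {N : ℕ} (A : Fin (N + 1) → Matrix ι κ ℂ) :
    ∃ B : Fin (N + 1) → Matrix ι (Fin (N + 1) × ι) ℂ, ∀ z,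
      matEval B z * (matEval B z)ᴴ = matEval A z * (matEval A z)ᴴ := by
  -- P P^* on the circle or elsewhere depends only on the Gram matrix of the stacked coefficients,
  -- which is refactored here with `β = 0`, an empty band condition. A fixed number of columns is
  -- what makes the later compactness argument possible.
  set G : Matrix (Fin (N + 1) × ι) κ ℂ := Matrix.of fun p γ => A p.1 p.2 γ
  obtain ⟨v, -, -, hv⟩ := (Matrix.posSemidef_self_mul_conjTranspose G).exists_banded_decomposition
    (fun _ => 0) 0 Finset.univ _ (by simp) (by simp)
  refine ⟨fun n => Matrix.of fun i γ => v γ (n, i), fun z => ?_⟩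
  ext i j
  simp only [matEval_mul_conjTranspose_apply, Matrix.of_apply, ← hv]
  simp [G, Matrix.mul_apply]

/-- A finite sum over a window does not change when the window is shifted to the origin. -/
theorem sum_range_pow_mul_eq_of_support {M N b : ℕ} (w : ℕ → ℂ) (z : ℂ)
    (hw : ∀ i, w i ≠ 0 → i < M ∧ b ≤ i ∧ i ≤ b + N) :
    ∑ i ∈ Finset.range M, z ^ i * w i = z ^ b * ∑ n ∈ Finset.range (N + 1), z ^ n * w (b + n) := by
  have h1 : ∑ i ∈ Finset.range M, z ^ i * w i = ∑ i ∈ Finset.range (M + b + N + 1), z ^ i * w i :=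
    Finset.sum_subset (by intro i; simp only [Finset.mem_range]; omega) fun i _ hi => by
      have : w i = 0 := by
        by_contra h
        exact hi (Finset.mem_range.2 (hw i h).1)
      rw [this, mul_zero]
  have h2 : ∑ i ∈ Finset.Ico b (b + (N + 1)), z ^ i * w i =
      ∑ i ∈ Finset.range (M + b + N + 1), z ^ i * w i :=
    Finset.sum_subset (by intro i; simp only [Finset.mem_range, Finset.mem_Ico]; omega)
      fun i _ hi => by
      have : w i = 0 := by
        by_contra h
        have := (hw i h).2
        exact hi (Finset.mem_Ico.2 (by omega))
      rw [this, mul_zero]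
  rw [h1, ← h2, Finset.sum_Ico_eq_sum_range, Finset.mul_sum, Nat.add_sub_cancel_left]
  exact Finset.sum_congr rfl fun n _ => by rw [pow_add, mul_assoc]

/-- The partial sums of the Fejér type for a trigonometric polynomial that is nonnegative on the
circle factor. -/
theorem exists_factor_fejer_sum {m N : ℕ} {C : ℤ → Matrix (Fin m) (Fin m) ℂ}
    (hS : ∀ z : ℂ, ‖z‖ = 1 → (trigMatrixPoly N C z).PosSemidef) (M : ℕ) :
    ∃ B : Fin (N + 1) → Matrix (Fin m) (Fin (N + 1) × Fin m) ℂ, ∀ z : ℂ, ‖z‖ = 1 →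
      matEval B z * (matEval B z)ᴴ = ∑ i ∈ Finset.range M, ∑ i' ∈ Finset.range M,
        z ^ ((i : ℤ) - i') • bandCoeff N C ((i : ℤ) - i') := by
  obtain ⟨v, hsupp, -, hv⟩ := (toeplitz_posSemidef hS M).exists_banded_decomposition
    (fun p => (p.1 : ℕ)) N Finset.univ _ (by
      intro p q hpq
      by_contra hlt
      exact hpq (by
        rw [Matrix.of_apply, bandCoeff_eq_zero (by rw [Finset.mem_Icc]; omega), Matrix.zero_apply]))
    (by simp)
  -- Extension by 0 past M lets the window from j to j + N run over the edge.
  set w : Fin M × Fin m → Fin m → ℕ → ℂ := fun j α i => if h : i < M then v j (⟨i, h⟩, α) else 0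
    with hw
  have hwsupp : ∀ j α i, w j α i ≠ 0 → i < M ∧ (j.1 : ℕ) ≤ i ∧ i ≤ (j.1 : ℕ) + N := by
    intro j α i hi
    by_cases h : i < M
    · simp only [hw, h, dif_pos] at hi
      exact ⟨h, hsupp j _ hi⟩
    · simp [hw, h] at hi
  obtain ⟨B, hB⟩ := exists_matEval_mul_conjTranspose_eq
    (fun n : Fin (N + 1) => (Matrix.of fun α j => w j α ((j.1 : ℕ) + n) :
      Matrix (Fin m) (Fin M × Fin m) ℂ))
  refine ⟨B, fun z hz => ?_⟩
  have hz0 : z ≠ 0 := fun h => by simp [h] at hz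
  have hstar := star_eq_inv_of_norm_eq_one hz
  rw [hB]
  ext α β
  have hcol : ∀ j γ, z ^ (j.1 : ℕ) * ∑ n : Fin (N + 1), z ^ (n : ℕ) * w j γ ((j.1 : ℕ) + n) =
      ∑ i : Fin M, z ^ (i : ℕ) * v j (i, γ) := by
    intro j γ
    rw [Fin.sum_univ_eq_sum_range (fun n => z ^ n * w j γ ((j.1 : ℕ) + n)),
      ← sum_range_pow_mul_eq_of_support _ _ (hwsupp j γ), ← Fin.sum_univ_eq_sum_range
      (fun i => z ^ i * w j γ i)]
    exact Finset.sum_congr rfl fun i _ => by simp [hw]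
  calc _ = ∑ j, (∑ i : Fin M, z ^ (i : ℕ) * v j (i, α)) *
        star (∑ i : Fin M, z ^ (i : ℕ) * v j (i, β)) := by
        rw [Matrix.mul_apply]
        refine Finset.sum_congr rfl fun j _ => ?_
        -- Column j is z^j times a polynomial of degree at most N, and the unimodular factor z^j
        -- cancels in the product with the adjoint.
        have h1 : z ^ (j.1 : ℕ) * star (z ^ (j.1 : ℕ)) = 1 := by
          rw [star_pow, hstar, ← mul_pow, mul_inv_cancel₀ hz0, one_pow]
        rw [← hcol, ← hcol, star_mul', mul_mul_mul_comm, h1, one_mul, Matrix.conjTranspose_apply,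
          matEval_apply, matEval_apply]
        rfl
    _ = ∑ i : Fin M, ∑ i' : Fin M, z ^ ((i : ℤ) - (i' : ℤ)) *
        ∑ j, v j (i, α) * star (v j (i', β)) := by
        simp only [star_sum, Finset.sum_mul_sum]
        simp only [Finset.mul_sum]
        rw [Finset.sum_comm]
        refine Finset.sum_congr rfl fun i _ => ?_
        rw [Finset.sum_comm]
        refine Finset.sum_congr rfl fun i' _ => Finset.sum_congr rfl fun j _ => ?_
        rw [star_mul', star_pow, hstar, zpow_sub₀ hz0, zpow_natCast, zpow_natCast, inv_pow]
        ring
    _ = _ := by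
        simp only [← hv, Matrix.of_apply, Matrix.sum_apply, Matrix.smul_apply, smul_eq_mul]
        rw [← Fin.sum_univ_eq_sum_range (fun i => ∑ i' ∈ Finset.range M,
          z ^ ((i : ℤ) - i') * bandCoeff N C ((i : ℤ) - i') α β)]
        refine Finset.sum_congr rfl fun i _ => ?_
        rw [← Fin.sum_univ_eq_sum_range (fun i' =>
          z ^ (((i : ℕ) : ℤ) - i') * bandCoeff N C (((i : ℕ) : ℤ) - i') α β)]

theorem sum_Icc_neg_eq_sum_range {E : Type*} [AddCommMonoid E] (F : ℤ → E) (M : ℕ) :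
    ∑ n ∈ Finset.Icc (-(M : ℤ)) M, F n = ∑ k ∈ Finset.range (M + (M + 1)), F ((k : ℤ) - M) := by
  refine Finset.sum_nbij' (fun n => (n + M).toNat) (fun k => (k : ℤ) - M) ?_ ?_ ?_ ?_ ?_ <;>
    intro n <;> simp only [Finset.mem_Icc, Finset.mem_range] <;> intro hn
  · omega
  · omega
  · omega
  · omega
  · congr 1
    omega

/-- A sum over differences is a sum of symmetric partial sums. -/
theorem sum_range_sum_range_sub {E : Type*} [AddCommMonoid E] (F : ℤ → E) (M : ℕ) :
    ∑ i ∈ Finset.range M, ∑ i' ∈ Finset.range M, F ((i : ℤ) - i') =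
      ∑ k ∈ Finset.range M, ∑ n ∈ Finset.Icc (-(k : ℤ)) k, F n := by
  induction M with
  | zero => simp
  | succ M ih =>
    -- The new last row and last column of the index grid together form the symmetric partial sum of
    -- order M.
    have h1 : ∑ i' ∈ Finset.range (M + 1), F ((M : ℤ) - i') = ∑ j ∈ Finset.range (M + 1), F j := by
      rw [← Finset.sum_range_reflect]
      refine Finset.sum_congr rfl fun j hj => ?_
      rw [Finset.mem_range] at hj
      congr 1
      omega
    have h2 : ∑ n ∈ Finset.Icc (-(M : ℤ)) M, F n =
        ∑ i ∈ Finset.range M, F ((i : ℤ) - M) + ∑ j ∈ Finset.range (M + 1), F j := by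
      rw [sum_Icc_neg_eq_sum_range, Finset.sum_range_add]
      congr 1
      exact Finset.sum_congr rfl fun j _ => by congr 1; push_cast; ring
    rw [Finset.sum_range_succ (fun k : ℕ => ∑ n ∈ Finset.Icc (-(k : ℤ)) k, F n), ← ih, h2,
      Finset.sum_range_succ (fun i : ℕ => ∑ i' ∈ Finset.range (M + 1), F ((i : ℤ) - i')), h1,
      ← add_assoc, ← Finset.sum_add_distrib]
    congr 1
    exact Finset.sum_congr rfl fun i _ => Finset.sum_range_succ _ _

theorem isCompact_setOf_norm_le {ν ι κ : Type*} [Finite ν] [Finite ι] [Finite κ] (R : ℝ) :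
    IsCompact {A : ν → Matrix ι κ ℂ | ∀ n i j, ‖A n i j‖ ≤ R} := by
  have h : IsCompact {A : ν → ι → κ → ℂ |
      ∀ n, A n ∈ {a : ι → κ → ℂ | ∀ i, a i ∈ {b : κ → ℂ | ∀ j, b j ∈ Metric.closedBall 0 R}}} :=
    isCompact_pi_infinite fun _ => isCompact_pi_infinite fun _ => isCompact_pi_infinite fun _ =>
      isCompact_closedBall _ _
  simp only [mem_closedBall_zero_iff, Set.mem_ofPred_eq] at h
  exact h

theorem continuous_matEval {ι κ : Type*} {N : ℕ} (z : ℂ) :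
    Continuous fun A : Fin (N + 1) → Matrix ι κ ℂ => matEval A z := by
  unfold matEval
  fun_prop

theorem continuous_matEval_mul_conjTranspose {ι κ : Type*} [Fintype κ] {N : ℕ} (z : ℂ) :
    Continuous fun A : Fin (N + 1) → Matrix ι κ ℂ => matEval A z * (matEval A z)ᴴ :=
  (continuous_matEval z).matrix_mul (continuous_matEval z).matrix_conjTranspose

theorem norm_sq_le_norm_mul_conjTranspose {ι κ : Type*} [Fintype κ] (X : Matrix ι κ ℂ) (i : ι)
    (j : κ) : ‖X i j‖ ^ 2 ≤ ‖(X * Xᴴ) i i‖ := by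
  have h : (X * Xᴴ) i i = ((∑ γ, ‖X i γ‖ ^ 2 : ℝ) : ℂ) := by
    rw [Matrix.mul_apply, Complex.ofReal_sum]
    refine Finset.sum_congr rfl fun γ _ => ?_
    rw [Matrix.conjTranspose_apply, Complex.ofReal_pow]
    exact Complex.mul_conj' _
  rw [h, Complex.norm_real, Real.norm_of_nonneg (by positivity)]
  exact Finset.single_le_sum (f := fun γ => ‖X i γ‖ ^ 2) (fun _ _ => by positivity)
    (Finset.mem_univ j)

/-- The coefficients of a matrix polynomial are bounded by its values on the circle. -/
theorem norm_coeff_le {ι κ : Type*} [Fintype κ] {N : ℕ} (A : Fin (N + 1) → Matrix ι κ ℂ) {K : ℝ}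
    (hA : ∀ z : ℂ, ‖z‖ = 1 → ∀ i, ‖(matEval A z * (matEval A z)ᴴ) i i‖ ≤ K) (n : Fin (N + 1))
    (i : ι) (j : κ) : ‖A n i j‖ ≤ Real.sqrt K := by
  -- Exponents between 0 and N differ by at most N, so N + 1 roots of unity recover each
  -- coefficient.
  obtain ⟨L, hLdef⟩ : ∃ L : ℕ, L = N + 1 := ⟨_, rfl⟩
  have hL : L ≠ 0 := by omega
  obtain ⟨ζ, hζ, hnorm⟩ := exists_isPrimitiveRoot_norm_eq_one hL
  have hval : ∀ z : ℂ, ‖z‖ = 1 → ‖matEval A z i j‖ ≤ Real.sqrt K := fun z hz =>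
    Real.le_sqrt_of_sq_le ((norm_sq_le_norm_mul_conjTranspose _ i j).trans (hA z hz i))
  have hsum : ∑ l ∈ Finset.range L, (ζ ^ l) ^ (-((n : ℕ) : ℤ)) * matEval A (ζ ^ l) i j =
      L * A n i j := by
    simp only [matEval_apply, Finset.mul_sum]
    rw [Finset.sum_comm]
    have : ∀ n' : Fin (N + 1), ∑ l ∈ Finset.range L,
        (ζ ^ l) ^ (-((n : ℕ) : ℤ)) * ((ζ ^ l) ^ (n' : ℕ) * A n' i j) =
        if n' = n then L * A n' i j else 0 := by
      intro n'
      have h1 : ∀ l ∈ Finset.range L, (ζ ^ l) ^ (-((n : ℕ) : ℤ)) * ((ζ ^ l) ^ (n' : ℕ) * A n' i j) =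
          (ζ ^ l) ^ (((n' : ℕ) : ℤ) - (n : ℕ)) * A n' i j := fun l _ => by
        have h0 : ζ ^ l ≠ 0 := fun h => by simpa [h] using hnorm l
        rw [sub_eq_neg_add, zpow_add₀ h0, zpow_natCast (ζ ^ l) n', mul_assoc]
      rw [Finset.sum_congr rfl h1, ← Finset.sum_mul, sum_zpow_of_isPrimitiveRoot hζ
        (by rw [abs_lt]; omega)]
      simp only [sub_eq_zero, Nat.cast_inj, Fin.val_inj, ite_mul, zero_mul]
    simp only [this, Finset.sum_ite_eq', Finset.mem_univ, if_true]
  have hle : ‖(L : ℂ) * A n i j‖ ≤ L * Real.sqrt K := by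
    rw [← hsum]
    refine (norm_sum_le _ _).trans ((Finset.sum_le_sum fun l _ => ?_).trans_eq
      (by rw [Finset.sum_const, Finset.card_range, nsmul_eq_mul]))
    rw [norm_mul, norm_zpow, hnorm, one_zpow, one_mul]
    exact hval _ (hnorm l)
  rw [norm_mul, Complex.norm_natCast] at hle
  exact le_of_mul_le_mul_left hle (by positivity)

/-- A trigonometric matrix polynomial that is nonnegative on the circle factors on the circle. -/
theorem exists_factor_on_circle {m N : ℕ} {C : ℤ → Matrix (Fin m) (Fin m) ℂ}
    (hS : ∀ z : ℂ, ‖z‖ = 1 → (trigMatrixPoly N C z).PosSemidef) :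
    ∃ B : Fin (N + 1) → Matrix (Fin m) (Fin (N + 1) × Fin m) ℂ, ∀ z : ℂ, ‖z‖ = 1 →
      matEval B z * (matEval B z)ᴴ = trigMatrixPoly N C z := by
  choose B hB using exists_factor_fejer_sum hS
  set u : ℂ → Fin m → Fin m → ℕ → ℂ := fun z α β k =>
    ∑ n ∈ Finset.Icc (-(k : ℤ)) k, z ^ n * bandCoeff N C n α β
  -- With this scaling `A M` factors the mean of the first M symmetric partial sums. These equal S
  -- from order N on, so the means converge to S. For M = 0 the scalar is 0 and no bound is
  -- affected.
  set A : ℕ → Fin (N + 1) → Matrix (Fin m) (Fin (N + 1) × Fin m) ℂ := fun M n =>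
    ((Real.sqrt (M : ℝ))⁻¹ : ℝ) • B M n
  have hAB : ∀ M z, matEval (A M) z = ((Real.sqrt (M : ℝ))⁻¹ : ℝ) • matEval (B M) z := by
    intro M z
    simp only [matEval, A, Finset.smul_sum]
    exact Finset.sum_congr rfl fun n _ => smul_comm _ _ _
  have hA : ∀ M z α β, ‖z‖ = 1 → (matEval (A M) z * (matEval (A M) z)ᴴ) α β =
      ((M : ℝ)⁻¹) • ∑ k ∈ Finset.range M, u z α β k := by
    intro M z α β hz
    rw [hAB, Matrix.conjTranspose_smul, Matrix.smul_mul, Matrix.mul_smul, smul_smul, star_trivial,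
      ← mul_inv, Real.mul_self_sqrt (Nat.cast_nonneg M), hB M z hz, sum_range_sum_range_sub
      (fun n => z ^ n • bandCoeff N C n)]
    simp [u, Matrix.sum_apply]
  have hlim : ∀ z α β, ‖z‖ = 1 → Filter.Tendsto
      (fun M => (matEval (A M) z * (matEval (A M) z)ᴴ) α β) Filter.atTop
      (nhds (trigMatrixPoly N C z α β)) := by
    intro z α β hz
    simp only [hA _ z α β hz]
    refine Filter.Tendsto.cesaro_smul (tendsto_const_nhds.congr' ?_)
    filter_upwards [Filter.eventually_ge_atTop N] with k hk
    rw [trigMatrixPoly_eq_sum_of_le C z hk]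
    simp [u, Matrix.sum_apply]
  -- `K` bounds the diagonal entries of all partial sums uniformly on the circle, hence all the
  -- coefficients of the `A M` by √K.
  set K : ℝ := ∑ α, ∑ n ∈ Finset.Icc (-(N : ℤ)) N, ‖bandCoeff N C n α α‖
  have hu : ∀ z α k, ‖z‖ = 1 → ‖u z α α k‖ ≤ K := by
    intro z α k hz
    calc ‖u z α α k‖ ≤ ∑ n ∈ Finset.Icc (-(k : ℤ)) k, ‖bandCoeff N C n α α‖ := by
          refine (norm_sum_le _ _).trans_eq (Finset.sum_congr rfl fun n _ => ?_)
          rw [norm_mul, norm_zpow, hz, one_zpow, one_mul]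
      _ ≤ ∑ n ∈ Finset.Icc (-(N : ℤ)) N, ‖bandCoeff N C n α α‖ := by
          rw [← Finset.sum_filter_of_ne (p := (· ∈ Finset.Icc (-(N : ℤ)) N)) fun n _ hn => by
            by_contra h
            exact hn (by rw [bandCoeff_eq_zero h]; simp)]
          exact Finset.sum_le_sum_of_subset_of_nonneg (fun n hn => (Finset.mem_filter.1 hn).2)
            fun _ _ _ => norm_nonneg _
      _ ≤ K := Finset.single_le_sum
          (f := fun α => ∑ n ∈ Finset.Icc (-(N : ℤ)) N, ‖bandCoeff N C n α α‖)
          (fun _ _ => by positivity) (Finset.mem_univ α)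
  have hK : 0 ≤ K := by positivity
  have hbd : ∀ M, A M ∈ {A : Fin (N + 1) → Matrix (Fin m) (Fin (N + 1) × Fin m) ℂ |
      ∀ n i j, ‖A n i j‖ ≤ Real.sqrt K} := by
    intro M
    refine norm_coeff_le (A M) fun z hz α => ?_
    rw [hA M z α α hz, norm_smul, norm_inv, Real.norm_natCast]
    have h : ‖∑ k ∈ Finset.range M, u z α α k‖ ≤ M * K :=
      (norm_sum_le _ _).trans ((Finset.sum_le_sum fun k _ => hu z α k hz).trans_eq (by simp))
    calc (M : ℝ)⁻¹ * ‖∑ k ∈ Finset.range M, u z α α k‖ ≤ (M : ℝ)⁻¹ * (M * K) := by gcongr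
      _ ≤ K := by
        rw [← mul_assoc]
        exact mul_le_of_le_one_left hK inv_mul_le_one
  have : FirstCountableTopology (Fin (N + 1) → Matrix (Fin m) (Fin (N + 1) × Fin m) ℂ) :=
    inferInstanceAs (FirstCountableTopology (Fin (N + 1) → Fin m → Fin (N + 1) × Fin m → ℂ))
  obtain ⟨A', -, φ, hφ, hconv⟩ := (isCompact_setOf_norm_le _).tendsto_subseq hbd
  refine ⟨A', fun z hz => ?_⟩
  ext α β
  have h1 := ((continuous_apply_apply α β).tendsto _).comp
    (((continuous_matEval_mul_conjTranspose z).tendsto A').comp hconv)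
  exact tendsto_nhds_unique h1 ((hlim z α β hz).comp hφ.tendsto_atTop)

/-! ### Reflecting zeros out of the disc by energy minimization -/

/-- Replacing the component of a matrix along a unit vector. -/
theorem mul_conjTranspose_replace {ι κ : Type*} [Fintype κ] (X : Matrix ι κ ℂ) (v : κ → ℂ)
    (hv : star v ⬝ᵥ v = 1) (y : ι → ℂ) :
    (X + Matrix.vecMulVec (y - X *ᵥ v) (star v)) *
      (X + Matrix.vecMulVec (y - X *ᵥ v) (star v))ᴴ =
    X * Xᴴ - Matrix.vecMulVec (X *ᵥ v) (star (X *ᵥ v)) + Matrix.vecMulVec y (star y) := by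
  have h1 : X * (Matrix.vecMulVec (y - X *ᵥ v) (star v))ᴴ =
      Matrix.vecMulVec (X *ᵥ v) (star (y - X *ᵥ v)) := by
    rw [Matrix.conjTranspose_vecMulVec, star_star, Matrix.mul_vecMulVec]
  have h2 : Matrix.vecMulVec (y - X *ᵥ v) (star v) * Xᴴ =
      Matrix.vecMulVec (y - X *ᵥ v) (star (X *ᵥ v)) := by
    rw [Matrix.vecMulVec_mul, Matrix.star_mulVec]
  have h3 : Matrix.vecMulVec (y - X *ᵥ v) (star v) *
      (Matrix.vecMulVec (y - X *ᵥ v) (star v))ᴴ =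
      Matrix.vecMulVec (y - X *ᵥ v) (star (y - X *ᵥ v)) := by
    rw [Matrix.conjTranspose_vecMulVec, star_star, Matrix.vecMulVec_mul_vecMulVec, hv, one_smul]
  rw [Matrix.conjTranspose_add, Matrix.add_mul, Matrix.mul_add, Matrix.mul_add, h1, h2, h3]
  ext i j
  simp only [Matrix.add_apply, Matrix.sub_apply, Matrix.vecMulVec_apply, Pi.star_apply,
    Pi.sub_apply, star_sub]
  ring

/-- Division of a vector polynomial by `z - a`. The sequence `h` consists of the coefficients of
the quotient, shifted by one. -/
theorem exists_quotient_coeff {ι : Type*} (N : ℕ) (f : ℕ → ι → ℂ) (a : ℂ)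
    (ha : ∑ n ∈ Finset.range (N + 1), a ^ n • f n = 0) :
    ∃ h : ℕ → ι → ℂ, h 0 = 0 ∧ h (N + 1) = 0 ∧ ∀ n ≤ N, f n = h n - a • h (n + 1) := by
  -- These are the Horner tails. The one at 0 is the value of the polynomial at `a`, which vanishes.
  refine ⟨fun n => ∑ l ∈ Finset.Ico n (N + 1), a ^ (l - n) • f l, ?_, by simp, fun n hn => ?_⟩
  · simpa only [Finset.range_eq_Ico, Nat.sub_zero] using ha
  · simp only
    rw [Finset.sum_eq_sum_Ico_succ_bot (by omega), Nat.sub_self, pow_zero, one_smul,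
      Finset.smul_sum, eq_comm, add_sub_assoc, add_eq_left, sub_eq_zero]
    refine Finset.sum_congr rfl fun l hl => ?_
    rw [Finset.mem_Ico] at hl
    rw [smul_smul, ← pow_succ', show l - (n + 1) + 1 = l - n by omega]

/-- Abel summation. The weight n in the energy is chosen so that coefficientwise differences add up
to a sum of squares. -/
theorem sum_range_mul_sub_succ (x : ℕ → ℝ) (N : ℕ) :
    ∑ n ∈ Finset.range (N + 1), (n : ℝ) * (x n - x (n + 1)) =
      ∑ n ∈ Finset.range (N + 1), x (n + 1) - (N + 1) * x (N + 1) := by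
  induction N with
  | zero => simp
  | succ N ih =>
    rw [Finset.sum_range_succ, ih, Finset.sum_range_succ (fun n => x (n + 1)) (N + 1)]
    push_cast
    ring

theorem sum_range_pow_smul_succ {ι : Type*} {N : ℕ} {h : ℕ → ι → ℂ} (h0 : h 0 = 0)
    (hN : h (N + 1) = 0) (z : ℂ) :
    ∑ n ∈ Finset.range (N + 1), z ^ n • h n =
      z • ∑ n ∈ Finset.range (N + 1), z ^ n • h (n + 1) := by
  have h1 := Finset.sum_range_succ (fun n => z ^ n • h n) (N + 1)
  rw [Finset.sum_range_succ', hN, h0, smul_zero, smul_zero, add_zero, add_zero] at h1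
  rw [← h1, Finset.smul_sum]
  exact Finset.sum_congr rfl fun n _ => by rw [smul_smul, pow_succ']

/-- The weighted energy `∑ n ‖A_n‖²` of the coefficients of a matrix polynomial. -/
noncomputable def weightedEnergy {ι κ : Type*} [Fintype ι] [Fintype κ] {N : ℕ}
    (A : Fin (N + 1) → Matrix ι κ ℂ) : ℝ :=
  ∑ n : Fin (N + 1), ((n : ℕ) : ℝ) * ((A n * (A n)ᴴ).trace).re

theorem continuous_weightedEnergy {ι κ : Type*} [Fintype ι] [Fintype κ] {N : ℕ} :
    Continuous fun A : Fin (N + 1) → Matrix ι κ ℂ => weightedEnergy A := by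
  unfold weightedEnergy
  refine continuous_finsetSum _ fun n _ => continuous_const.mul (Complex.continuous_re.comp ?_)
  exact Continuous.matrix_trace (by fun_prop)

theorem re_trace_vecMulVec_star {ι : Type*} [Fintype ι] (y : ι → ℂ) :
    (Matrix.vecMulVec y (star y)).trace.re = ∑ i, Complex.normSq (y i) := by
  simp [Matrix.trace, Matrix.vecMulVec_apply, Complex.mul_conj]

/-- Moving a zero of one column direction from inside the disc to its mirror image preserves
`P P^*` on the circle and strictly decreases the weighted energy. -/
theorem exists_weightedEnergy_lt {ι κ : Type*} [Fintype ι] [Fintype κ] {N : ℕ}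
    (A : Fin (N + 1) → Matrix ι κ ℂ) {a : ℂ} (ha : ‖a‖ < 1) {v : κ → ℂ}
    (hv : star v ⬝ᵥ v = 1) (hav : matEval A a *ᵥ v = 0) {n₀ : Fin (N + 1)}
    (hn₀ : A n₀ *ᵥ v ≠ 0) :
    ∃ B : Fin (N + 1) → Matrix ι κ ℂ, weightedEnergy B < weightedEnergy A ∧
      ∀ z : ℂ, ‖z‖ = 1 → matEval B z * (matEval B z)ᴴ = matEval A z * (matEval A z)ᴴ := by
  set f : ℕ → ι → ℂ := fun n => if h : n < N + 1 then A ⟨n, h⟩ *ᵥ v else 0 with hf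
  have hfin : ∀ n : Fin (N + 1), f n = A n *ᵥ v := fun n => dif_pos n.2
  have hfz : ∀ z, matEval A z *ᵥ v = ∑ n ∈ Finset.range (N + 1), z ^ n • f n := by
    intro z
    rw [← Fin.sum_univ_eq_sum_range (fun n => z ^ n • f n), matEval, Matrix.sum_mulVec]
    exact Finset.sum_congr rfl fun n _ => by rw [hfin, Matrix.smul_mulVec]
  obtain ⟨h, h0, hN, hh⟩ := exists_quotient_coeff N f a (by rw [← hfz, hav])
  -- If A(z)v = (z - a)G(z), then `y` lists the coefficients of (1 - ā z)G(z). `B` sends v to this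
  -- polynomial and agrees with `A` on the orthogonal complement of v.
  set y : ℕ → ι → ℂ := fun n => h (n + 1) - star a • h n with hy
  set B : Fin (N + 1) → Matrix ι κ ℂ := fun n =>
    A n + Matrix.vecMulVec (y n - A n *ᵥ v) (star v)
  have hBz : ∀ z, matEval B z = matEval A z + Matrix.vecMulVec
      ((∑ n ∈ Finset.range (N + 1), z ^ n • y n) - matEval A z *ᵥ v) (star v) := by
    intro z
    rw [← Fin.sum_univ_eq_sum_range (fun n => z ^ n • y n)]
    have h1 : matEval A z *ᵥ v = ∑ n : Fin (N + 1), z ^ (n : ℕ) • (A n *ᵥ v) := by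
      simp only [matEval, Matrix.sum_mulVec, Matrix.smul_mulVec]
    rw [h1]
    ext i j
    simp only [matEval_apply, B, Matrix.add_apply, Matrix.vecMulVec_apply, Pi.sub_apply,
      Finset.sum_apply, Pi.smul_apply, smul_eq_mul]
    rw [← Finset.sum_sub_distrib, Finset.sum_mul, ← Finset.sum_add_distrib]
    exact Finset.sum_congr rfl fun n _ => by ring
  set x : ℕ → ℝ := fun n => ∑ i, Complex.normSq (h n i) with hx
  have hxnn : ∀ n, 0 ≤ x n := fun n => Finset.sum_nonneg fun i _ => Complex.normSq_nonneg _
  refine ⟨B, ?_, fun z hz => ?_⟩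
  -- The mixed terms of |h_n - a h_{n+1}|² and |h_{n+1} - ā h_n|² coincide, leaving a difference
  -- that telescopes.
  · have hterm : ∀ n : Fin (N + 1), ((A n * (A n)ᴴ).trace).re - ((B n * (B n)ᴴ).trace).re =
        (1 - ‖a‖ ^ 2) * (x n - x (n + 1)) := by
      intro n
      have hn := hh n (by omega)
      rw [mul_conjTranspose_replace _ _ hv, Matrix.trace_add, Matrix.trace_sub, Complex.add_re,
        Complex.sub_re, re_trace_vecMulVec_star, re_trace_vecMulVec_star, ← hfin, hn]
      have hi : ∀ i, Complex.normSq ((h n - a • h (n + 1)) i) - Complex.normSq (y n i) =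
          (1 - ‖a‖ ^ 2) * (Complex.normSq (h n i) - Complex.normSq (h (n + 1) i)) := by
        intro i
        rw [← Complex.normSq_eq_norm_sq]
        simp only [hy, Pi.sub_apply, Pi.smul_apply, smul_eq_mul, Complex.star_def,
          Complex.normSq_apply, Complex.sub_re, Complex.sub_im, Complex.mul_re, Complex.mul_im,
          Complex.conj_re, Complex.conj_im]
        ring
      rw [hx, ← Finset.sum_sub_distrib, Finset.mul_sum, ← Finset.sum_congr rfl fun i _ => hi i,
        Finset.sum_sub_distrib]
      ring
    have hdiff : weightedEnergy A - weightedEnergy B =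
        (1 - ‖a‖ ^ 2) * ∑ n ∈ Finset.range (N + 1), x (n + 1) := by
      have hxN : x (N + 1) = 0 := by simp [hx, hN]
      have h1 := sum_range_mul_sub_succ x N
      rw [hxN, mul_zero, sub_zero, ← Fin.sum_univ_eq_sum_range
        (fun n => (n : ℝ) * (x n - x (n + 1)))] at h1
      rw [← h1, weightedEnergy, weightedEnergy, ← Finset.sum_sub_distrib, Finset.mul_sum]
      refine Finset.sum_congr rfl fun n _ => ?_
      rw [← mul_sub, hterm]
      ring
    have hpos : 0 < ∑ n ∈ Finset.range (N + 1), x (n + 1) := by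
      refine lt_of_le_of_ne (Finset.sum_nonneg fun n _ => hxnn _) fun hzero => hn₀ ?_
      have hall := (Finset.sum_eq_zero_iff_of_nonneg fun n _ => hxnn (n + 1)).1 hzero.symm
      have hh0 : ∀ n ≤ N + 1, h n = 0 := by
        intro n hn
        rcases n with _ | n
        · exact h0
        · have := hall n (Finset.mem_range.2 (by omega))
          funext i
          exact Complex.normSq_eq_zero.1 ((Finset.sum_eq_zero_iff_of_nonneg
            fun i _ => Complex.normSq_nonneg _).1 this i (Finset.mem_univ i))
      rw [← hfin, hh _ (by omega), hh0 _ (by omega), hh0 _ (by omega), smul_zero, sub_zero]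
    have : 0 < 1 - ‖a‖ ^ 2 := by nlinarith [norm_nonneg a]
    have := mul_pos this hpos
    linarith
  · rw [hBz, mul_conjTranspose_replace _ _ hv, hfz]
    set G : ι → ℂ := ∑ n ∈ Finset.range (N + 1), z ^ n • h (n + 1)
    have hG : ∑ n ∈ Finset.range (N + 1), z ^ n • h n = z • G := sum_range_pow_smul_succ h0 hN z
    have h1 : ∑ n ∈ Finset.range (N + 1), z ^ n • f n = (z - a) • G := by
      rw [sub_smul, ← hG, Finset.smul_sum, ← Finset.sum_sub_distrib]
      refine Finset.sum_congr rfl fun n hn => ?_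
      rw [hh n (by rw [Finset.mem_range] at hn; omega), smul_sub, smul_comm]
    have h2 : ∑ n ∈ Finset.range (N + 1), z ^ n • y n = (1 - star a * z) • G := by
      rw [sub_smul, one_smul, mul_smul, ← hG, Finset.smul_sum, ← Finset.sum_sub_distrib]
      exact Finset.sum_congr rfl fun n _ => by rw [hy, smul_sub, smul_comm]
    have hz0 : z ≠ 0 := fun h => by simp [h] at hz
    -- On the circle |z - a| = |1 - ā z|.
    have h3 : (z - a) * star (z - a) = (1 - star a * z) * star (1 - star a * z) := by
      rw [star_sub, star_sub, star_mul', star_star, star_one, star_eq_inv_of_norm_eq_one hz]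
      field_simp
    rw [h1, h2, sub_add_eq_add_sub, sub_eq_iff_eq_add, add_right_inj]
    ext i j
    simp only [Matrix.vecMulVec_apply, Pi.star_apply, Pi.smul_apply, smul_eq_mul]
    rw [star_mul', star_mul', mul_mul_mul_comm, ← h3, mul_mul_mul_comm]

/-- A matrix function that factors on the circle has a factor whose null directions inside the
disc are trivial. -/
theorem exists_factor_on_circle_trivial_kernel {m N : ℕ} {κ : Type*} [Fintype κ]
    {S : ℂ → Matrix (Fin m) (Fin m) ℂ} {A₀ : Fin (N + 1) → Matrix (Fin m) κ ℂ}
    (hA₀ : ∀ z : ℂ, ‖z‖ = 1 → matEval A₀ z * (matEval A₀ z)ᴴ = S z) :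
    ∃ A : Fin (N + 1) → Matrix (Fin m) κ ℂ,
      (∀ z : ℂ, ‖z‖ = 1 → matEval A z * (matEval A z)ᴴ = S z) ∧
      ∀ a : ℂ, ‖a‖ < 1 → ∀ v : κ → ℂ, matEval A a *ᵥ v = 0 → ∀ n, A n *ᵥ v = 0 := by
  set F : Set (Fin (N + 1) → Matrix (Fin m) κ ℂ) :=
    {A | ∀ z : ℂ, ‖z‖ = 1 → matEval A z * (matEval A z)ᴴ = S z} with hF
  have hclosed : IsClosed F := by
    have : F = ⋂ (z : ℂ) (_ : ‖z‖ = 1), {A | matEval A z * (matEval A z)ᴴ = S z} := by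
      ext A
      simp [hF]
    rw [this]
    exact isClosed_iInter fun z => isClosed_iInter fun _ =>
      isClosed_eq (continuous_matEval_mul_conjTranspose z) continuous_const
  obtain ⟨K, hK⟩ : ∃ K : ℝ, ∀ z : ℂ, ‖z‖ = 1 → ∀ i, ‖S z i i‖ ≤ K := by
    have hcont : ∀ i, ContinuousOn (fun z => S z i i) (Metric.sphere 0 1) := fun i => by
      have : Continuous fun z => (matEval A₀ z * (matEval A₀ z)ᴴ) i i := by
        refine Continuous.matrix_elem ?_ i i
        unfold matEval
        fun_prop
      exact this.continuousOn.congr fun z hz => by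
        simp only [hA₀ z (by simpa using hz)]
    choose K hK using fun i => (isCompact_sphere (0 : ℂ) 1).exists_bound_of_continuousOn (hcont i)
    refine ⟨∑ i, |K i|, fun z hz i => (hK i z (by simpa using hz)).trans ((le_abs_self _).trans ?_)⟩
    exact Finset.single_le_sum (f := fun i => |K i|) (fun _ _ => abs_nonneg _) (Finset.mem_univ i)
  have hcompact : IsCompact F :=
    (isCompact_setOf_norm_le (Real.sqrt K)).of_isClosed_subset hclosed fun A hA =>
      norm_coeff_le A fun z hz i => by rw [hA z hz]; exact hK z hz i
  -- An energy minimiser admits no further reflection. A null vector not killed by all coefficients,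
  -- once normalised, would permit one.
  obtain ⟨A, hA, hmin⟩ := hcompact.exists_isMinOn ⟨A₀, hA₀⟩ continuous_weightedEnergy.continuousOn
  refine ⟨A, hA, fun a ha v hav n => ?_⟩
  by_contra hn
  have hv0 : v ≠ 0 := fun h => hn (by rw [h, Matrix.mulVec_zero])
  set r : ℝ := ∑ i, Complex.normSq (v i)
  have hr : star v ⬝ᵥ v = (r : ℂ) := by
    simp [dotProduct, r, Complex.normSq_eq_conj_mul_self]
  have hr0 : 0 < r := by
    refine lt_of_le_of_ne (Finset.sum_nonneg fun i _ => Complex.normSq_nonneg _) fun h => hv0 ?_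
    refine dotProduct_star_self_eq_zero.1 ?_
    exact hr.trans (by rw [← h, Complex.ofReal_zero])
  have hs : Real.sqrt r ≠ 0 := (Real.sqrt_pos.2 hr0).ne'
  obtain ⟨B, hlt, hB⟩ := exists_weightedEnergy_lt A ha (v := ((Real.sqrt r)⁻¹ : ℝ) • v) (n₀ := n)
    (by
      rw [star_smul, star_trivial, smul_dotProduct, dotProduct_smul, hr, smul_smul, ← mul_inv,
        Real.mul_self_sqrt hr0.le, Complex.real_smul, ← Complex.ofReal_mul,
        inv_mul_cancel₀ hr0.ne', Complex.ofReal_one])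
    (by rw [Matrix.mulVec_smul, hav, smul_zero])
    (by rw [Matrix.mulVec_smul]; exact smul_ne_zero (inv_ne_zero hs) hn)
  exact absurd (hmin (fun z hz => (hB z hz).trans (hA z hz) : B ∈ F)) (not_le.2 hlt)

/-! ### Removing superfluous columns -/

theorem matEval_zero {ι κ : Type*} {N : ℕ} (A : Fin (N + 1) → Matrix ι κ ℂ) :
    matEval A 0 = A 0 := by
  rw [matEval, Fin.sum_univ_succ]
  simp

theorem sum_subtype_eq_sum_of_support {κ : Type*} [Fintype κ] {p : κ → Prop} [DecidablePred p]
    (f : κ → ℂ) (hf : ∀ i, ¬p i → f i = 0) : ∑ i : {i // p i}, f i = ∑ i, f i := by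
  rw [← Finset.sum_subtype (Finset.univ.filter p) (by simp) f]
  exact Finset.sum_filter_of_ne fun i _ hi => by
    by_contra h
    exact hi (hf i h)

/-- Removing the common kernel of the coefficients of a matrix polynomial. -/
theorem exists_injective_columns {ι κ : Type*} [Fintype ι] [Fintype κ] [DecidableEq κ] {N : ℕ}
    {A : Fin (N + 1) → Matrix ι κ ℂ}
    (hA : ∀ a : ℂ, ‖a‖ < 1 → ∀ v : κ → ℂ, matEval A a *ᵥ v = 0 → ∀ n, A n *ᵥ v = 0) :
    ∃ (k : ℕ) (B : Fin (N + 1) → Matrix ι (Fin k) ℂ),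
      (∀ z, matEval B z * (matEval B z)ᴴ = matEval A z * (matEval A z)ᴴ) ∧
      ∀ a : ℂ, ‖a‖ < 1 → ∀ x : Fin k → ℂ, matEval B a *ᵥ x = 0 → x = 0 := by
  -- By `hA` at the origin, the kernel of `A 0` is the common kernel of all coefficients. In an
  -- eigenbasis of `(A 0)ᴴ * A 0`, columns with eigenvalue 0 vanish identically and the others are
  -- kept.
  have hH : ((A 0)ᴴ * A 0).IsHermitian := Matrix.isHermitian_conjTranspose_mul_self _
  set U : Matrix κ κ ℂ := (hH.eigenvectorUnitary : Matrix κ κ ℂ)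
  have hUU : U * Uᴴ = 1 := Unitary.coe_mul_star_self hH.eigenvectorUnitary
  have hUU' : Uᴴ * U = 1 := Unitary.coe_star_mul_self hH.eigenvectorUnitary
  have hdiag : (A 0)ᴴ * A 0 * U = U * Matrix.diagonal (fun i => (hH.eigenvalues i : ℂ)) := by
    have h := hH.spectral_theorem
    rw [Unitary.conjStarAlgAut_apply] at h
    conv_lhs => rw [h]
    rw [Matrix.mul_assoc]
    change _ * (Uᴴ * U) = _
    rw [hUU', Matrix.mul_one]
    rfl
  have hcol : ∀ i, hH.eigenvalues i = 0 → ∀ n α, (A n * U) α i = 0 := by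
    intro i hi n α
    have h1 : ((A 0)ᴴ * A 0) *ᵥ (U *ᵥ Pi.single i 1) = 0 := by
      rw [Matrix.mulVec_mulVec, hdiag, ← Matrix.mulVec_mulVec, Matrix.diagonal_mulVec_single, hi]
      simp
    have h2 : A 0 *ᵥ (U *ᵥ Pi.single i 1) = 0 :=
      (Matrix.conjTranspose_mul_self_mulVec_eq_zero _ _).1 h1
    have h3 := congrFun (hA 0 (by simp) _ (by rw [matEval_zero, h2]) n) α
    rw [Matrix.mulVec_mulVec, Matrix.mulVec_single_one] at h3
    exact h3
  set e := Fintype.equivFin {i // hH.eigenvalues i ≠ 0}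
  have hsub : ∀ z, matEval (fun n => (A n * U).submatrix id (fun γ => (e.symm γ : κ))) z =
      (matEval A z * U).submatrix id (fun γ => (e.symm γ : κ)) := by
    intro z
    ext i j
    simp only [matEval_apply, Matrix.mul_apply, Matrix.submatrix_apply, Finset.sum_mul,
      Finset.mul_sum, mul_assoc, id]
    rw [Finset.sum_comm]
  refine ⟨_, fun n => (A n * U).submatrix id (fun γ => (e.symm γ : κ)), fun z => ?_,
    fun a ha x hx => ?_⟩
  · have hzero : ∀ i, hH.eigenvalues i = 0 → ∀ α, (matEval A z * U) α i = 0 := by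
      intro i hi α
      have : matEval A z * U = ∑ n : Fin (N + 1), z ^ (n : ℕ) • (A n * U) := by
        simp [matEval, Matrix.sum_mul]
      simp [this, Matrix.sum_apply, hcol i hi]
    have hprod : matEval A z * (matEval A z)ᴴ = (matEval A z * U) * (matEval A z * U)ᴴ := by
      rw [Matrix.conjTranspose_mul, Matrix.mul_assoc, ← Matrix.mul_assoc U, hUU, Matrix.one_mul]
    rw [hsub, hprod]
    ext α β
    simp only [Matrix.mul_apply (M := Matrix.submatrix _ _ _),
      Matrix.mul_apply (M := matEval A z * U), Matrix.conjTranspose_apply, Matrix.submatrix_apply,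
      id]
    rw [Equiv.sum_comp e.symm (fun i : {i // hH.eigenvalues i ≠ 0} =>
      (matEval A z * U) α i * star ((matEval A z * U) β i)),
      sum_subtype_eq_sum_of_support (p := fun i => hH.eigenvalues i ≠ 0)
      (fun i => (matEval A z * U) α i * star ((matEval A z * U) β i))
      fun i hi => by rw [hzero i (not_not.1 hi), zero_mul]]
  -- Extended by zero, x becomes a null direction of `A` at a, hence of `A 0`. The diagonal form
  -- then kills each entry with nonzero eigenvalue, and these are all the entries of x.
  · set y : κ → ℂ := fun i => if h : hH.eigenvalues i ≠ 0 then x (e ⟨i, h⟩) else 0 with hy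
    have hsum : matEval A a *ᵥ (U *ᵥ y) = 0 := by
      rw [← hx, hsub, Matrix.mulVec_mulVec]
      ext α
      simp only [Matrix.mulVec, dotProduct, Matrix.submatrix_apply, id]
      rw [← Equiv.sum_comp e, ← sum_subtype_eq_sum_of_support
        (p := fun i => hH.eigenvalues i ≠ 0) _ fun i hi => by simp only [hy, dif_neg hi, mul_zero]]
      exact Finset.sum_congr rfl fun i _ => by simp [hy, i.2]
    have h1 : (U * Matrix.diagonal fun i => (hH.eigenvalues i : ℂ)) *ᵥ y = 0 := by
      rw [← hdiag, ← Matrix.mulVec_mulVec, ← Matrix.mulVec_mulVec, hA a ha _ hsum 0,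
        Matrix.mulVec_zero]
    have h2 : (Matrix.diagonal fun i => (hH.eigenvalues i : ℂ)) *ᵥ y = 0 := by
      rw [← Matrix.one_mulVec (Matrix.mulVec _ y), ← hUU', ← Matrix.mulVec_mulVec,
        Matrix.mulVec_mulVec _ U, h1, Matrix.mulVec_zero]
    funext γ
    have h3 := congrFun h2 (e.symm γ : κ)
    rw [Matrix.mulVec_diagonal] at h3
    have h4 := (mul_eq_zero.1 h3).resolve_left (Complex.ofReal_ne_zero.2 (e.symm γ).2)
    simpa [hy, (e.symm γ).2] using h4

/-! ### Left inverses, determinants and the generic rank -/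

/-- A complex matrix with trivial kernel has a left inverse. -/
theorem exists_left_inverse_of_ker {ι : Type*} [Fintype ι] {k : ℕ} {X : Matrix ι (Fin k) ℂ}
    (hX : ∀ x, X *ᵥ x = 0 → x = 0) : ∃ L : Matrix (Fin k) ι ℂ, L * X = 1 := by
  refine ⟨(Xᴴ * X)⁻¹ * Xᴴ, ?_⟩
  rw [Matrix.mul_assoc]
  refine Matrix.nonsing_inv_mul _ (isUnit_iff_ne_zero.2 fun hdet => ?_)
  obtain ⟨v, hv, h⟩ := Matrix.exists_mulVec_eq_zero_iff.2 hdet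
  exact hv (hX v ((Matrix.conjTranspose_mul_self_mulVec_eq_zero _ _).1 h))

theorem rank_eq_of_left_inverse_det_ne_zero {ι : Type*} [Fintype ι] {k : ℕ}
    {X : Matrix ι (Fin k) ℂ} {L : Matrix (Fin k) ι ℂ} (h : (L * X).det ≠ 0) : X.rank = k := by
  refine le_antisymm ((Matrix.rank_le_card_width X).trans_eq (Fintype.card_fin k)) ?_
  have h1 := Matrix.rank_mul_le_right L X
  rwa [Matrix.rank_of_isUnit _ ((Matrix.isUnit_iff_isUnit_det _).2 (isUnit_iff_ne_zero.2 h)),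
    Fintype.card_fin] at h1

theorem exists_left_inverse_of_rank {ι : Type*} [Fintype ι] {k : ℕ} {X : Matrix ι (Fin k) ℂ}
    (hX : X.rank = k) : ∃ L : Matrix (Fin k) ι ℂ, L * X = 1 := by
  refine exists_left_inverse_of_ker fun x hx => ?_
  have h := LinearMap.finrank_range_add_finrank_ker X.mulVecLin
  rw [Module.finrank_fin_fun] at h
  have hk : Module.finrank ℂ (LinearMap.ker X.mulVecLin) = 0 := by
    have : Module.finrank ℂ (LinearMap.range X.mulVecLin) = k := hX
    omega
  rw [Submodule.finrank_eq_zero] at hk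
  have : x ∈ LinearMap.ker X.mulVecLin := by simpa using hx
  rwa [hk, Submodule.mem_bot] at this

/-- The matrix with polynomial entries that belongs to a list of coefficients. -/
noncomputable def coeffPolynomial {ι κ : Type*} {N : ℕ} (A : Fin (N + 1) → Matrix ι κ ℂ) :
    Matrix ι κ (Polynomial ℂ) :=
  Matrix.of fun i j => ∑ n : Fin (N + 1), Polynomial.C (A n i j) * Polynomial.X ^ (n : ℕ)

theorem coeffPolynomial_map_eval {ι κ : Type*} {N : ℕ} (A : Fin (N + 1) → Matrix ι κ ℂ) (z : ℂ) :
    (coeffPolynomial A).map (Polynomial.evalRingHom z) = matEval A z := by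
  ext i j
  simp only [coeffPolynomial, matEval_apply, Matrix.map_apply, Matrix.of_apply,
    Polynomial.coe_evalRingHom, Polynomial.eval_finsetSum, Polynomial.eval_mul, Polynomial.eval_C,
    Polynomial.eval_pow, Polynomial.eval_X]
  exact Finset.sum_congr rfl fun n _ => mul_comm _ _

theorem map_C_mul_coeffPolynomial_map_eval {ι κ μ : Type*} [Fintype ι] {N : ℕ} (L : Matrix μ ι ℂ)
    (A : Fin (N + 1) → Matrix ι κ ℂ) (z : ℂ) :
    (L.map Polynomial.C * coeffPolynomial A).map (Polynomial.evalRingHom z) =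
      L * matEval A z := by
  rw [Matrix.map_mul, coeffPolynomial_map_eval]
  congr 1
  ext i j
  simp

/-- For fixed L, full column rank is witnessed by a single scalar polynomial. If L is a left inverse
at one point, this polynomial is nonzero, so the rank drops at only finitely many points. -/
theorem eval_det_map_C_mul_coeffPolynomial {ι : Type*} [Fintype ι] {k N : ℕ}
    (L : Matrix (Fin k) ι ℂ) (A : Fin (N + 1) → Matrix ι (Fin k) ℂ) (z : ℂ) :
    (L.map Polynomial.C * coeffPolynomial A).det.eval z = (L * matEval A z).det := by
  rw [← map_C_mul_coeffPolynomial_map_eval, ← Polynomial.coe_evalRingHom, RingHom.map_det]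
  rfl

theorem infinite_unit_circle : {z : ℂ | ‖z‖ = 1}.Infinite := by
  have h : IsPreconnected (Metric.sphere (0 : ℂ) 1) :=
    isPreconnected_sphere (by rw [Complex.rank_real_complex]; exact Nat.one_lt_ofNat) 0 1
  have h2 := h.infinite_of_nontrivial ⟨1, by simp, -1, by simp, by norm_num⟩
  simpa [Metric.sphere] using h2

/-- A property that holds almost everywhere on the circle holds outside any finite set. -/
theorem exists_circle_of_ae {p : ℂ → Prop} (hp : ∀ᵐ θ : ℝ, p (Circle.exp θ : ℂ)) {F : Set ℂ}
    (hF : F.Finite) : ∃ z : ℂ, ‖z‖ = 1 ∧ z ∉ F ∧ p z := by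
  have hopen : IsOpen {θ : ℝ | (Circle.exp θ : ℂ) ∉ F} :=
    hF.isClosed.isOpen_compl.preimage (by fun_prop : Continuous fun θ : ℝ => (Circle.exp θ : ℂ))
  obtain ⟨w, hw, hwF⟩ := (infinite_unit_circle.sdiff hF).nonempty
  have hne : {θ : ℝ | (Circle.exp θ : ℂ) ∉ F}.Nonempty := by
    refine ⟨w.arg, ?_⟩
    have : (Circle.exp w.arg : ℂ) = w := by
      rw [Circle.coe_exp, ← one_mul (Complex.exp _), ← Complex.ofReal_one, ← (hw : ‖w‖ = 1),
        Complex.norm_mul_exp_arg_mul_I]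
    rwa [Set.mem_ofPred_eq, this]
  obtain ⟨θ, hθF, hθ⟩ := (Measure.dense_of_ae hp).inter_open_nonempty _ hopen hne
  exact ⟨Circle.exp θ, Circle.norm_coe _, hθF, hθ⟩

/-- The number of columns of a factor with trivial kernel in the disc is the generic rank. -/
theorem card_columns_eq_of_ae_rank {m k k' N : ℕ} {S : ℂ → Matrix (Fin m) (Fin m) ℂ}
    {B : Fin (N + 1) → Matrix (Fin m) (Fin k') ℂ}
    (hS : ∀ᵐ θ : ℝ, (S (Circle.exp θ : ℂ)).rank = k)
    (hB : ∀ z : ℂ, ‖z‖ = 1 → matEval B z * (matEval B z)ᴴ = S z)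
    (hker : ∀ x, matEval B 0 *ᵥ x = 0 → x = 0) : k' = k := by
  obtain ⟨L, hL⟩ := exists_left_inverse_of_ker hker
  set q := (L.map Polynomial.C * coeffPolynomial B).det
  have hq : q ≠ 0 := fun h => by
    have h0 := eval_det_map_C_mul_coeffPolynomial L B 0
    rw [hL, Matrix.det_one] at h0
    change q.eval 0 = 1 at h0
    simp [h] at h0
  obtain ⟨z, hz, hzF, hrank⟩ := exists_circle_of_ae (p := fun z => (S z).rank = k) hS
    (F := {z | q.IsRoot z}) (Polynomial.finite_setOfPred_isRoot hq)
  have hdet : (L * matEval B z).det ≠ 0 := by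
    rw [← eval_det_map_C_mul_coeffPolynomial]
    exact hzF
  rw [← hrank, ← hB z hz, Matrix.rank_self_mul_conjTranspose,
    rank_eq_of_left_inverse_det_ne_zero hdet]

/-! ### From the circle to the punctured plane -/

/-- The coefficients of a Laurent polynomial are determined by its values on the circle. -/
theorem laurent_coeff_eq_zero {N : ℕ} {D : ℤ → ℂ}
    (hD : ∀ z : ℂ, ‖z‖ = 1 → ∑ n ∈ Finset.Icc (-(N : ℤ)) N, z ^ n * D n = 0) {n₀ : ℤ}
    (hn₀ : n₀ ∈ Finset.Icc (-(N : ℤ)) N) : D n₀ = 0 := by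
  -- Two exponents between -N and N differ by at most 2N.
  have hL : 2 * N + 1 ≠ 0 := by omega
  obtain ⟨ζ, hζ, hnorm⟩ := exists_isPrimitiveRoot_norm_eq_one hL
  have h1 : ∑ l ∈ Finset.range (2 * N + 1), (ζ ^ l) ^ (-n₀) *
      ∑ n ∈ Finset.Icc (-(N : ℤ)) N, (ζ ^ l) ^ n * D n = 0 :=
    Finset.sum_eq_zero fun l _ => by rw [hD _ (hnorm l), mul_zero]
  simp only [Finset.mul_sum] at h1
  rw [Finset.sum_comm] at h1
  have h2 : ∀ n ∈ Finset.Icc (-(N : ℤ)) N, ∑ l ∈ Finset.range (2 * N + 1),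
      (ζ ^ l) ^ (-n₀) * ((ζ ^ l) ^ n * D n) =
      if n = n₀ then ((2 * N + 1 : ℕ) : ℂ) * D n else 0 := by
    intro n hn
    have h3 : ∀ l ∈ Finset.range (2 * N + 1), (ζ ^ l) ^ (-n₀) * ((ζ ^ l) ^ n * D n) =
        (ζ ^ l) ^ (n - n₀) * D n := fun l _ => by
      have h0 : ζ ^ l ≠ 0 := fun h => by simpa [h] using hnorm l
      rw [sub_eq_neg_add, zpow_add₀ h0, mul_assoc]
    rw [Finset.mem_Icc] at hn hn₀
    rw [Finset.sum_congr rfl h3, ← Finset.sum_mul, sum_zpow_of_isPrimitiveRoot hζ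
      (by rw [abs_lt]; constructor <;> push_cast <;> omega)]
    simp only [sub_eq_zero, ite_mul, zero_mul]
  rw [Finset.sum_congr rfl h2, Finset.sum_ite_eq', if_pos hn₀] at h1
  exact (mul_eq_zero.1 h1).resolve_left (Nat.cast_ne_zero.2 hL)

/-- The coefficients of the product `S⁺ S⁻`. -/
noncomputable def productCoeff {m k N : ℕ} (A : Fin (N + 1) → Matrix (Fin m) (Fin k) ℂ) (n : ℤ) :
    Matrix (Fin m) (Fin m) ℂ :=
  ∑ i : Fin (N + 1), ∑ j : Fin (N + 1),
    if ((i : ℕ) : ℤ) - ((j : ℕ) : ℤ) = n then A i * (A j)ᴴ else 0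

theorem plusPoly_mul_minusPoly {m k N : ℕ} (A : Fin (N + 1) → Matrix (Fin m) (Fin k) ℂ) {z : ℂ}
    (hz : z ≠ 0) : plusPoly A z * minusPoly A z =
      ∑ n ∈ Finset.Icc (-(N : ℤ)) N, z ^ n • productCoeff A n := by
  simp only [productCoeff, Finset.smul_sum]
  rw [Finset.sum_comm, plusPoly, minusPoly, Matrix.sum_mul]
  refine Finset.sum_congr rfl fun i _ => ?_
  rw [Finset.sum_comm, Matrix.mul_sum]
  refine Finset.sum_congr rfl fun j _ => ?_
  simp only [smul_ite, smul_zero]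
  rw [Finset.sum_ite_eq, if_pos (by rw [Finset.mem_Icc]; omega), Matrix.smul_mul, Matrix.mul_smul,
    smul_smul, sub_eq_add_neg, zpow_add₀ hz, zpow_natCast]

theorem minusPoly_eq_conjTranspose {m k N : ℕ} (A : Fin (N + 1) → Matrix (Fin m) (Fin k) ℂ) {z : ℂ}
    (hz : ‖z‖ = 1) : minusPoly A z = (plusPoly A z)ᴴ := by
  rw [minusPoly, plusPoly, Matrix.conjTranspose_sum]
  refine Finset.sum_congr rfl fun n _ => ?_
  rw [Matrix.conjTranspose_smul, star_pow, star_eq_inv_of_norm_eq_one hz, zpow_neg, inv_pow,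
    zpow_natCast]

/-- A factorization on the circle determines the coefficients. -/
theorem eq_productCoeff_of_circle {m k N : ℕ} {C : ℤ → Matrix (Fin m) (Fin m) ℂ}
    {A : Fin (N + 1) → Matrix (Fin m) (Fin k) ℂ}
    (h : ∀ z : ℂ, ‖z‖ = 1 → plusPoly A z * (plusPoly A z)ᴴ = trigMatrixPoly N C z) {n : ℤ}
    (hn : n ∈ Finset.Icc (-(N : ℤ)) N) : C n = productCoeff A n := by
  ext α β
  rw [← sub_eq_zero]
  refine laurent_coeff_eq_zero (D := fun n => C n α β - productCoeff A n α β) (fun z hz => ?_) hn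
  have hz0 : z ≠ 0 := fun h => by simp [h] at hz
  have h1 := congrFun (congrFun (h z hz) α) β
  rw [← minusPoly_eq_conjTranspose A hz, plusPoly_mul_minusPoly A hz0, trigMatrixPoly] at h1
  simp only [Matrix.sum_apply, Matrix.smul_apply, smul_eq_mul] at h1
  simp only [mul_sub, Finset.sum_sub_distrib, h1, sub_self]

theorem productCoeff_top {m k N : ℕ} (A : Fin (N + 1) → Matrix (Fin m) (Fin k) ℂ)
    (hA : A (Fin.last N) = 0) : productCoeff A N = 0 := by
  refine Finset.sum_eq_zero fun i _ => Finset.sum_eq_zero fun j _ => ?_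
  split_ifs with h
  · have : i = Fin.last N := Fin.ext (by simp only [Fin.val_last]; omega)
    rw [this, hA, Matrix.zero_mul]
  · rfl

/-- Values on the circle determine the Laurent coefficients, so the factorization extends to all z ≠
0. The top coefficient of the product is A_N A_0^*, so A_N = 0 would contradict `hN`. -/
theorem isSpectralFactor_of_circle {m k N : ℕ} {C : ℤ → Matrix (Fin m) (Fin m) ℂ}
    (hN : C (N : ℤ) ≠ 0) {A : Fin (N + 1) → Matrix (Fin m) (Fin k) ℂ}
    (h : ∀ z : ℂ, ‖z‖ = 1 → plusPoly A z * (plusPoly A z)ᴴ = trigMatrixPoly N C z)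
    (hrank : ∀ z : ℂ, ‖z‖ < 1 → (plusPoly A z).rank = k) :
    IsSpectralFactor (trigMatrixPoly N C) A where
  order hA := hN (by
    rw [eq_productCoeff_of_circle h (by rw [Finset.mem_Icc]; omega), productCoeff_top A hA])
  fullRank := hrank
  factor z hz := by
    rw [plusPoly_mul_minusPoly A hz, trigMatrixPoly]
    exact Finset.sum_congr rfl fun n hn => by rw [eq_productCoeff_of_circle h hn]

theorem exists_isSpectralFactor {m k N : ℕ} {C : ℤ → Matrix (Fin m) (Fin m) ℂ}
    (hN : C (N : ℤ) ≠ 0)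
    (hS : ∀ᵐ θ : ℝ, (trigMatrixPoly N C (Circle.exp θ : ℂ)).PosSemidef ∧
      (trigMatrixPoly N C (Circle.exp θ : ℂ)).rank = k) :
    ∃ A : Fin (N + 1) → Matrix (Fin m) (Fin k) ℂ, IsSpectralFactor (trigMatrixPoly N C) A := by
  obtain ⟨A₀, hA₀⟩ := exists_factor_on_circle (N := N) (C := C) fun z hz =>
    trigMatrixPoly_posSemidef (hS.mono fun _ h => h.1) hz
  obtain ⟨A₁, hA₁, hker₁⟩ := exists_factor_on_circle_trivial_kernel hA₀
  obtain ⟨k', B, hB, hker⟩ := exists_injective_columns hker₁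
  have hBS : ∀ z : ℂ, ‖z‖ = 1 → matEval B z * (matEval B z)ᴴ = trigMatrixPoly N C z :=
    fun z hz => (hB z).trans (hA₁ z hz)
  obtain rfl : k' = k :=
    card_columns_eq_of_ae_rank (hS.mono fun _ h => h.2) hBS (hker 0 (by simp))
  refine ⟨B, isSpectralFactor_of_circle hN hBS fun z hz => ?_⟩
  obtain ⟨L, hL⟩ := exists_left_inverse_of_ker (hker z hz)
  refine rank_eq_of_left_inverse_det_ne_zero (L := L) ?_
  change (L * matEval B z).det ≠ 0
  rw [hL, Matrix.det_one]
  exact one_ne_zero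

/-! ### Rational functions on the circle -/

theorem mem_closure_circle_diff {F : Set ℂ} (hF : F.Finite) {z : ℂ} (hz : ‖z‖ = 1) :
    z ∈ closure ({w : ℂ | ‖w‖ = 1} \ F) := by
  have h : IsPreconnected (Metric.sphere (0 : ℂ) 1) :=
    isPreconnected_sphere (by rw [Complex.rank_real_complex]; exact Nat.one_lt_ofNat) 0 1
  have hp := preperfect_iff_nhds.1
    (h.preperfect_of_nontrivial ⟨1, by simp, -1, by simp, by norm_num⟩)
  rw [mem_closure_iff_nhds]
  intro U hU
  obtain ⟨y, ⟨⟨hyU, hyF⟩, hy⟩, hyz⟩ := hp z (by simpa using hz) (U ∩ (F \ {z})ᶜ)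
    (Filter.inter_mem hU ((hF.sdiff).isClosed.isOpen_compl.mem_nhds (by simp)))
  exact ⟨y, hyU, by simpa using hy, fun h => hyF ⟨h, hyz⟩⟩

theorem polynomial_eq_of_circle {p q : Polynomial ℂ} {F : Set ℂ} (hF : F.Finite)
    (h : ∀ z : ℂ, ‖z‖ = 1 → z ∉ F → p.eval z = q.eval z) : p = q :=
  Polynomial.eq_of_infinite_eval_eq p q
    ((infinite_unit_circle.sdiff hF).mono fun z hz => h z hz.1 hz.2)

/-- On the circle and outside `F`, the function `u` is a quotient of two polynomials whose
denominator does not vanish at `a`. -/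
def RationalOnCircleAt (u : ℂ → ℂ) (F : Set ℂ) (a : ℂ) : Prop :=
  ∃ p q : Polynomial ℂ, q.eval a ≠ 0 ∧ ∀ z : ℂ, ‖z‖ = 1 → z ∉ F → u z * q.eval z = p.eval z

theorem Polynomial.exists_isCoprime_factor (p q : Polynomial ℂ) (hq : q ≠ 0) :
    ∃ d p' q' : Polynomial ℂ, d ≠ 0 ∧ p = d * p' ∧ q = d * q' ∧ IsCoprime p' q' := by
  classical
  obtain ⟨p', hp'⟩ := EuclideanDomain.gcd_dvd_left p q
  obtain ⟨q', hq'⟩ := EuclideanDomain.gcd_dvd_right p q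
  have hab := EuclideanDomain.gcd_eq_gcd_ab p q
  have hd : EuclideanDomain.gcd p q ≠ 0 := fun h => hq (by rw [hq', h, zero_mul])
  refine ⟨_, p', q', hd, hp', hq', EuclideanDomain.gcdA p q, EuclideanDomain.gcdB p q, ?_⟩
  refine mul_left_cancel₀ hd ?_
  calc _ = (EuclideanDomain.gcd p q * p') * EuclideanDomain.gcdA p q +
        (EuclideanDomain.gcd p q * q') * EuclideanDomain.gcdB p q := by ring
    _ = _ := by rw [← hp', ← hq', ← hab, mul_one]

/-- A bounded function on the circle that extends to the disc as a rational function has a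
representation whose denominator has no zeros in the closed disc. -/
theorem exists_coprime_representation {u : ℂ → ℂ} {F : Set ℂ} (hF : F.Finite)
    (hu : ∀ z : ℂ, ‖z‖ = 1 → z ∉ F → ‖u z‖ ≤ 1)
    (hrep : ∀ a : ℂ, ‖a‖ < 1 → RationalOnCircleAt u F a) :
    ∃ (p q : Polynomial ℂ) (G : Set ℂ), IsCoprime p q ∧ (∀ z : ℂ, ‖z‖ ≤ 1 → q.eval z ≠ 0) ∧
      G.Finite ∧ ∀ z : ℂ, ‖z‖ = 1 → z ∉ G → u z * q.eval z = p.eval z := by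
  obtain ⟨p₀, q₀, hq₀, h₀⟩ := hrep 0 (by simp)
  obtain ⟨d, p, q, hd, rfl, rfl, hcop⟩ :=
    p₀.exists_isCoprime_factor q₀ (fun h => hq₀ (by simp [h]))
  have hG : (F ∪ {z | d.IsRoot z}).Finite := hF.union (Polynomial.finite_setOfPred_isRoot hd)
  have hupq : ∀ z : ℂ, ‖z‖ = 1 → z ∉ F ∪ {z | d.IsRoot z} → u z * q.eval z = p.eval z := by
    intro z hz hzG
    have h := h₀ z hz fun h => hzG (Or.inl h)
    have hdz : d.eval z ≠ 0 := fun h => hzG (Or.inr h)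
    rw [Polynomial.eval_mul, Polynomial.eval_mul, mul_left_comm] at h
    exact mul_left_cancel₀ hdz h
  have hnotboth : ∀ z, q.eval z = 0 → p.eval z ≠ 0 := by
    obtain ⟨a, b, hab⟩ := hcop
    intro z hq hp
    have := congrArg (Polynomial.eval z) hab
    simp [hq, hp] at this
  refine ⟨p, q, _, hcop, fun z hz hqz => hnotboth z hqz ?_, hG, hupq⟩
  rcases hz.lt_or_eq with hlt | heq
  -- Inside the disc, a zero of q is also a zero of p, by comparison with a representation whose
  -- denominator does not vanish there.
  · obtain ⟨p₁, q₁, hq₁, h₁⟩ := hrep z hlt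
    have heq : p * q₁ = p₁ * q := polynomial_eq_of_circle hG fun w hw hwG => by
      rw [Polynomial.eval_mul, Polynomial.eval_mul, ← hupq w hw hwG,
        ← h₁ w hw fun h => hwG (Or.inl h)]
      ring
    have := congrArg (Polynomial.eval z) heq
    rw [Polynomial.eval_mul, Polynomial.eval_mul, hqz, mul_zero] at this
    exact (mul_eq_zero.1 this).resolve_right hq₁
  -- On the circle, boundedness of u gives |p| ≤ |q| off a finite set, hence everywhere, so a zero
  -- of q is again a zero of p.
  · have hcl : IsClosed {w : ℂ | ‖p.eval w‖ ≤ ‖q.eval w‖} :=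
      isClosed_le p.continuous.norm q.continuous.norm
    have hmem : z ∈ {w : ℂ | ‖p.eval w‖ ≤ ‖q.eval w‖} := by
      refine closure_minimal (fun w hw => ?_) hcl (mem_closure_circle_diff hG heq)
      rw [Set.mem_ofPred_eq, ← hupq w hw.1 hw.2, norm_mul]
      exact mul_le_of_le_one_left (norm_nonneg _) (hu w hw.1 fun h => hw.2 (Or.inl h))
    rw [Set.mem_ofPred_eq, hqz, norm_zero] at hmem
    exact norm_le_zero_iff.1 hmem

/-- The polynomial `z ↦ z^d * conj (f (1 / conj z))`. -/
noncomputable def conjReflect (d : ℕ) (f : Polynomial ℂ) : Polynomial ℂ :=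
  (f.map (starRingEnd ℂ)).reflect d

theorem eval_conjReflect {d : ℕ} {f : Polynomial ℂ} (hd : f.natDegree ≤ d) {z : ℂ} (hz : z ≠ 0) :
    (conjReflect d f).eval z = z ^ d * star (f.eval (star z⁻¹)) := by
  let _ : Invertible z⁻¹ := invertibleOfNonzero (inv_ne_zero hz)
  have h := Polynomial.eval₂_reflect_mul_pow (RingHom.id ℂ) z⁻¹ d (f.map (starRingEnd ℂ))
    (Polynomial.natDegree_map_le.trans hd)
  rw [invOf_eq_inv, inv_inv, inv_pow] at h
  have h2 : (f.map (starRingEnd ℂ)).eval z⁻¹ = star (f.eval (star z⁻¹)) := by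
    rw [Polynomial.eval_map]
    have := Polynomial.eval₂_at_apply (p := f) (starRingEnd ℂ) (star z⁻¹)
    rwa [starRingEnd_apply, star_star] at this
  rw [Polynomial.eval₂_id, Polynomial.eval₂_id, h2] at h
  rw [← h, mul_comm, mul_assoc, inv_mul_cancel₀ (pow_ne_zero d hz), mul_one, conjReflect]

theorem eval_conjReflect_of_norm_eq_one {d : ℕ} {f : Polynomial ℂ} (hd : f.natDegree ≤ d) {z : ℂ}
    (hz : ‖z‖ = 1) : (conjReflect d f).eval z = z ^ d * star (f.eval z) := by
  have hz0 : z ≠ 0 := fun h => by simp [h] at hz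
  rw [eval_conjReflect hd hz0, ← star_eq_inv_of_norm_eq_one hz, star_star]

theorem natDegree_conjReflect_le {d : ℕ} {f : Polynomial ℂ} (hd : f.natDegree ≤ d) :
    (conjReflect d f).natDegree ≤ d :=
  Polynomial.natDegree_reflect_le.trans (max_le le_rfl (Polynomial.natDegree_map_le.trans hd))

/-- If `p / q` and the conjugate of `r / s` agree on the circle, then `q` is constant. -/
theorem exists_eq_C_of_circle {p q r s : Polynomial ℂ} {F : Set ℂ} (hF : F.Finite)
    (hcop : IsCoprime p q) (hq : ∀ z : ℂ, ‖z‖ ≤ 1 → q.eval z ≠ 0)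
    (hs : ∀ z : ℂ, ‖z‖ ≤ 1 → s.eval z ≠ 0)
    (h : ∀ z : ℂ, ‖z‖ = 1 → z ∉ F → p.eval z * star (s.eval z) = star (r.eval z) * q.eval z) :
    ∃ c : ℂ, c ≠ 0 ∧ q = Polynomial.C c := by
  set d := max r.natDegree s.natDegree
  have hr : r.natDegree ≤ d := le_max_left _ _
  have hsd : s.natDegree ≤ d := le_max_right _ _
  have heq : p * conjReflect d s = conjReflect d r * q :=
    polynomial_eq_of_circle hF fun z hz hzF => by
      rw [Polynomial.eval_mul, Polynomial.eval_mul, eval_conjReflect_of_norm_eq_one hr hz,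
        eval_conjReflect_of_norm_eq_one hsd hz, mul_left_comm, h z hz hzF, mul_assoc]
  have hdvd : q ∣ conjReflect d s :=
    hcop.symm.dvd_of_dvd_mul_left (heq ▸ dvd_mul_left q _)
  have hdeg : q.degree = 0 := by
    by_contra hne
    obtain ⟨w, hw⟩ := Complex.exists_root (f := q) (by
      refine lt_of_le_of_ne ?_ (Ne.symm hne)
      exact Polynomial.zero_le_degree_iff.2 fun h0 => hq 0 (by simp) (by simp [h0]))
    have hw1 : 1 < ‖w‖ := by
      by_contra hle
      exact hq w (not_lt.1 hle) hw
    have hw0 : w ≠ 0 := fun h => by simp [h] at hw1; linarith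
    have h0 := Polynomial.eval_eq_zero_of_dvd_of_eval_eq_zero hdvd hw
    rw [eval_conjReflect hsd hw0] at h0
    have h1 := (mul_eq_zero.1 h0).resolve_left (pow_ne_zero _ hw0)
    -- As q divides the reflection of s, a zero w of q outside the closed disc reflects to a zero of
    -- s inside it.
    refine hs (star w⁻¹) ?_ (star_eq_zero.1 h1)
    rw [norm_star, norm_inv]
    exact inv_le_one_of_one_le₀ hw1.le
  have hqC := Polynomial.eq_C_of_degree_eq_zero hdeg
  refine ⟨q.coeff 0, fun h0 => hq 0 (by simp) ?_, hqC⟩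
  rw [hqC, h0]
  simp

/-- A function on the circle that is constant multiplied by a conjugate polynomial and a
polynomial at the same time is constant. -/
theorem exists_eq_C_of_eq_star {p r : Polynomial ℂ} {F : Set ℂ} (hF : F.Finite) {c : ℂ}
    (h : ∀ z : ℂ, ‖z‖ = 1 → z ∉ F → p.eval z = c * star (r.eval z)) :
    ∃ b : ℂ, p = Polynomial.C b := by
  set d := r.natDegree
  -- The reflection of r has degree at most d, so the factor X^d leaves p no positive degree.
  have heq : p * Polynomial.X ^ d = Polynomial.C c * conjReflect d r :=
    polynomial_eq_of_circle hF fun z hz hzF => by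
      rw [Polynomial.eval_mul, Polynomial.eval_mul, eval_conjReflect_of_norm_eq_one le_rfl hz,
        h z hz hzF, Polynomial.eval_C, Polynomial.eval_pow, Polynomial.eval_X]
      ring
  by_cases hp : p = 0
  · exact ⟨0, by simp [hp]⟩
  have hdeg : (p * Polynomial.X ^ d).natDegree ≤ d := by
    rw [heq]
    exact (Polynomial.natDegree_C_mul_le _ _).trans (natDegree_conjReflect_le le_rfl)
  rw [Polynomial.natDegree_mul_X_pow _ hp] at hdeg
  exact ⟨_, Polynomial.eq_C_of_natDegree_eq_zero (by omega)⟩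

/-- A bounded function on the circle that, together with its conjugate, extends to the disc as a
rational function is constant. -/
theorem exists_const_on_circle {u : ℂ → ℂ} {F : Set ℂ} (hF : F.Finite)
    (hu : ∀ z : ℂ, ‖z‖ = 1 → z ∉ F → ‖u z‖ ≤ 1)
    (hrep : ∀ a : ℂ, ‖a‖ < 1 → RationalOnCircleAt u F a)
    (hrep' : ∀ a : ℂ, ‖a‖ < 1 → RationalOnCircleAt (fun z => star (u z)) F a) :
    ∃ (c : ℂ) (G : Set ℂ), G.Finite ∧ ∀ z : ℂ, ‖z‖ = 1 → z ∉ G → u z = c := by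
  obtain ⟨p, q, G, hpq, hq, hG, h⟩ := exists_coprime_representation hF hu hrep
  obtain ⟨r, s, G', hrs, hs, hG', h'⟩ := exists_coprime_representation hF
    (u := fun z => star (u z)) (by simpa using hu) hrep'
  have hGG := hG.union hG'
  have h1 : ∀ z : ℂ, ‖z‖ = 1 → z ∉ G ∪ G' →
      p.eval z * star (s.eval z) = star (r.eval z) * q.eval z := fun z hz hzG => by
    rw [← h z hz fun h => hzG (Or.inl h), ← h' z hz fun h => hzG (Or.inr h), star_mul', star_star]
    ring
  obtain ⟨a, ha, rfl⟩ := exists_eq_C_of_circle hGG hpq hq hs h1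
  -- Conjugating the identity exchanges the two representations, so the other denominator is
  -- constant as well.
  obtain ⟨b, hb, rfl⟩ := exists_eq_C_of_circle hGG hrs hs hq (p := r) (r := p)
    fun z hz hzG => by
      have := congrArg star (h1 z hz hzG)
      simp only [star_mul', star_star] at this
      exact this.symm
  obtain ⟨e, rfl⟩ := exists_eq_C_of_eq_star hGG (p := p) (r := r) (c := a / star b)
    fun z hz hzG => by
      have := h1 z hz hzG
      rw [Polynomial.eval_C, Polynomial.eval_C] at this
      rw [div_mul_eq_mul_div, eq_div_iff (star_ne_zero.2 hb), this, mul_comm]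
  refine ⟨e / a, G, hG, fun z hz hzG => ?_⟩
  have := h z hz hzG
  rw [Polynomial.eval_C, Polynomial.eval_C] at this
  rw [eq_div_iff ha, this]

/-! ### Uniqueness up to a constant unitary -/

/-- Two factors of the same matrix differ by a unitary matrix if the first one is injective. -/
theorem exists_unitary_of_mul_conjTranspose_eq {ι : Type*} [Fintype ι] [DecidableEq ι] {k : ℕ}
    {X Y : Matrix ι (Fin k) ℂ} {L : Matrix (Fin k) ι ℂ} (hL : L * X = 1)
    (h : X * Xᴴ = Y * Yᴴ) : ∃ U ∈ Matrix.unitaryGroup (Fin k) ℂ, Y = X * U := by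
  refine ⟨L * Y, ?_, ?_⟩
  · rw [Matrix.mem_unitaryGroup_iff, Matrix.star_eq_conjTranspose, Matrix.conjTranspose_mul,
      Matrix.mul_assoc, ← Matrix.mul_assoc Y, ← h, Matrix.mul_assoc, ← Matrix.conjTranspose_mul,
      hL, Matrix.conjTranspose_one, Matrix.mul_one, hL]
  -- `1 - X * L` annihilates `X`, hence `X * Xᴴ = Y * Yᴴ`, hence `Y`.
  · have h1 : (1 - X * L) * X = 0 := by
      rw [Matrix.sub_mul, Matrix.one_mul, Matrix.mul_assoc, hL, Matrix.mul_one, sub_self]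
    have h2 : ((1 - X * L) * Y) * ((1 - X * L) * Y)ᴴ = 0 := by
      rw [Matrix.conjTranspose_mul, Matrix.mul_assoc, ← Matrix.mul_assoc Y, ← h,
        ← Matrix.mul_assoc, ← Matrix.mul_assoc, h1, Matrix.zero_mul, Matrix.zero_mul]
    have h3 := Matrix.self_mul_conjTranspose_eq_zero.1 h2
    rw [Matrix.sub_mul, Matrix.one_mul, sub_eq_zero] at h3
    rw [← Matrix.mul_assoc]
    exact h3

/-- Cramer's rule applied to L A V = L B, with L a left inverse of A at a, so that the denominator
det(L A) equals 1 there. As L depends on a, so does the representation. -/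
theorem rationalOnCircleAt_of_mul_eq {ι : Type*} [Fintype ι] {k N : ℕ}
    {A B : Fin (N + 1) → Matrix ι (Fin k) ℂ} {V : ℂ → Matrix (Fin k) (Fin k) ℂ} {F : Set ℂ}
    (h : ∀ z : ℂ, ‖z‖ = 1 → z ∉ F → matEval B z = matEval A z * V z) {a : ℂ}
    (ha : (matEval A a).rank = k) (i j : Fin k) : RationalOnCircleAt (fun z => V z i j) F a := by
  obtain ⟨L, hL⟩ := exists_left_inverse_of_rank ha
  set M := L.map Polynomial.C * coeffPolynomial A
  refine ⟨(M.adjugate * (L.map Polynomial.C * coeffPolynomial B)) i j, M.det, ?_,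
    fun z hz hzF => ?_⟩
  · rw [eval_det_map_C_mul_coeffPolynomial, hL, Matrix.det_one]
    exact one_ne_zero
  · have h1 : ((M.adjugate * (L.map Polynomial.C * coeffPolynomial B)).map
        (Polynomial.evalRingHom z)) = (L * matEval A z).det • V z := by
      rw [Matrix.map_mul, map_C_mul_coeffPolynomial_map_eval, h z hz hzF, ← Matrix.mul_assoc,
        ← Matrix.mul_assoc, Matrix.mul_assoc _ L]
      have : M.adjugate.map (Polynomial.evalRingHom z) = (L * matEval A z).adjugate := by
        rw [← map_C_mul_coeffPolynomial_map_eval]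
        exact RingHom.map_adjugate (Polynomial.evalRingHom z) M
      rw [this, Matrix.adjugate_mul, Matrix.smul_mul, Matrix.one_mul]
    have h2 := congrFun (congrFun h1 i) j
    rw [Matrix.map_apply, Polynomial.coe_evalRingHom] at h2
    rw [h2, eval_det_map_C_mul_coeffPolynomial, Matrix.smul_apply, smul_eq_mul, mul_comm]

/-- Two factors that agree on the circle and have full rank in the disc differ by a constant
unitary matrix. -/
theorem exists_unitary_of_circle {ι : Type*} [Fintype ι] [DecidableEq ι] {k N : ℕ}
    {A B : Fin (N + 1) → Matrix ι (Fin k) ℂ}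
    (hA : ∀ a : ℂ, ‖a‖ < 1 → (matEval A a).rank = k)
    (hB : ∀ a : ℂ, ‖a‖ < 1 → (matEval B a).rank = k)
    (h : ∀ z : ℂ, ‖z‖ = 1 → matEval A z * (matEval A z)ᴴ = matEval B z * (matEval B z)ᴴ) :
    ∃ U ∈ Matrix.unitaryGroup (Fin k) ℂ, ∀ z : ℂ, matEval B z = matEval A z * U := by
  obtain ⟨L, hL⟩ := exists_left_inverse_of_rank (hA 0 (by simp))
  set q := (L.map Polynomial.C * coeffPolynomial A).det
  have hq : q ≠ 0 := fun h0 => by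
    have h1 := eval_det_map_C_mul_coeffPolynomial L A 0
    rw [hL, Matrix.det_one] at h1
    change q.eval 0 = 1 at h1
    simp [h0] at h1
  set F : Set ℂ := {z | q.IsRoot z}
  have hF : F.Finite := Polynomial.finite_setOfPred_isRoot hq
  have hex : ∀ z : ℂ, ∃ U ∈ Matrix.unitaryGroup (Fin k) ℂ,
      ‖z‖ = 1 → z ∉ F → matEval B z = matEval A z * U := by
    intro z
    by_cases hz : ‖z‖ = 1 ∧ z ∉ F
    · have hdet : (L * matEval A z).det ≠ 0 := by
        rw [← eval_det_map_C_mul_coeffPolynomial]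
        exact hz.2
      obtain ⟨L', hL'⟩ := exists_left_inverse_of_rank (rank_eq_of_left_inverse_det_ne_zero hdet)
      obtain ⟨U, hU, hUB⟩ := exists_unitary_of_mul_conjTranspose_eq hL' (h z hz.1)
      exact ⟨U, hU, fun _ _ => hUB⟩
    -- Off the relevant part of the circle U(z) is arbitrary; the identity keeps it unitary for
    -- every z.
    · exact ⟨1, one_mem _, fun h1 h2 => absurd ⟨h1, h2⟩ hz⟩
  choose U hU hUB using hex
  -- Unitarity makes the relation symmetric. The entries of `(U z)ᴴ` are the conjugates of those of
  -- `U z`, so these too are rational without poles in the disc.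
  have hUA : ∀ z : ℂ, ‖z‖ = 1 → z ∉ F → matEval A z = matEval B z * (U z)ᴴ := by
    intro z hz hzF
    rw [hUB z hz hzF, Matrix.mul_assoc, ← Matrix.star_eq_conjTranspose,
      Matrix.mem_unitaryGroup_iff.1 (hU z), Matrix.mul_one]
  have hconst : ∀ i j, ∃ (c : ℂ) (G : Set ℂ), G.Finite ∧
      ∀ z : ℂ, ‖z‖ = 1 → z ∉ G → U z i j = c := fun i j =>
    exists_const_on_circle hF (fun z _ _ => entry_norm_bound_of_unitary (hU z) i j)
      (fun a ha => rationalOnCircleAt_of_mul_eq hUB (hA a ha) i j)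
      (fun a ha => rationalOnCircleAt_of_mul_eq (V := fun z => (U z)ᴴ) hUA (hB a ha) j i)
  choose c G hG hc using hconst
  have hfin : (F ∪ ⋃ i, ⋃ j, G i j).Finite :=
    hF.union (Set.finite_iUnion fun i => Set.finite_iUnion fun j => hG i j)
  have hUc : ∀ z : ℂ, ‖z‖ = 1 → z ∉ F ∪ ⋃ i, ⋃ j, G i j → U z = Matrix.of c := by
    intro z hz hzG
    ext i j
    exact hc i j z hz fun h => hzG (Or.inr (Set.mem_iUnion₂.2 ⟨i, j, h⟩))
  obtain ⟨w, hw, hwG⟩ := (infinite_unit_circle.sdiff hfin).nonempty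
  refine ⟨Matrix.of c, hUc w hw hwG ▸ hU w, fun z => ?_⟩
  have heq : coeffPolynomial B = coeffPolynomial A * (Matrix.of c).map Polynomial.C := by
    ext1 i j
    refine polynomial_eq_of_circle hfin fun z hz hzG => ?_
    have h1 := congrFun (congrFun (hUB z hz fun h => hzG (Or.inl h)) i) j
    rw [hUc z hz hzG, ← coeffPolynomial_map_eval, ← coeffPolynomial_map_eval] at h1
    simpa [Matrix.mul_apply, Polynomial.eval_finsetSum] using h1
  rw [← coeffPolynomial_map_eval, heq, Matrix.map_mul, coeffPolynomial_map_eval]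
  congr 1
  ext i j
  simp

theorem theorem1 (m k N : ℕ) (C : ℤ → Matrix (Fin m) (Fin m) ℂ)
    (hN : C (N : ℤ) ≠ 0)
    (hS : ∀ᵐ θ : ℝ, (trigMatrixPoly N C (Circle.exp θ : ℂ)).PosSemidef ∧
      (trigMatrixPoly N C (Circle.exp θ : ℂ)).rank = k) :
    ∃ A : Fin (N + 1) → Matrix (Fin m) (Fin k) ℂ,
      IsSpectralFactor (trigMatrixPoly N C) A ∧
      ∀ B : Fin (N + 1) → Matrix (Fin m) (Fin k) ℂ,
        IsSpectralFactor (trigMatrixPoly N C) B ↔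
          ∃ U ∈ Matrix.unitaryGroup (Fin k) ℂ, ∀ z : ℂ, plusPoly B z = plusPoly A z * U := by
  have hcirc : ∀ {A : Fin (N + 1) → Matrix (Fin m) (Fin k) ℂ},
      IsSpectralFactor (trigMatrixPoly N C) A → ∀ z : ℂ, ‖z‖ = 1 →
        plusPoly A z * (plusPoly A z)ᴴ = trigMatrixPoly N C z := fun hA z hz => by
    rw [← minusPoly_eq_conjTranspose _ hz, hA.factor z fun h => by simp [h] at hz]
  obtain ⟨A, hA⟩ := exists_isSpectralFactor hN hS
  refine ⟨A, hA, fun B => ⟨fun hB => ?_, ?_⟩⟩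
  · exact exists_unitary_of_circle hA.fullRank hB.fullRank fun z hz =>
      (hcirc hA z hz).trans (hcirc hB z hz).symm
  · rintro ⟨U, hU, hBU⟩
    refine isSpectralFactor_of_circle hN (fun z hz => ?_) fun z hz => ?_
    · rw [hBU, Matrix.conjTranspose_mul, Matrix.mul_assoc, ← Matrix.mul_assoc U,
        ← Matrix.star_eq_conjTranspose U, Matrix.mem_unitaryGroup_iff.1 hU, Matrix.one_mul,
        hcirc hA z hz]
    · rw [hBU, Matrix.rank_mul_eq_left_of_isUnit_det, hA.fullRank z hz]
      exact Matrix.UnitaryGroup.det_isUnit ⟨U, hU⟩
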